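/- Let $r$ and $N$ be positive integers and let $A=\{a(1),\dots,a(r)\}$ be a set of positive integers with $\sum_{i=1}^{k-1}a(i)<a(k)$ for all $1\le k\le r$ and $N\ge a(1)+\cdots+a(r)$. Let $A'$ be the set of sums of distinct elements of $A$ (with at least one summand); each $\alpha\in A'$ has a unique such expression, its *defining sum*. Let $w_A(\alpha)$ be the number of terms of this sum, and $v_A(\alpha)$, $z_A(\alpha)$ its smallest and largest term. For $\alpha,\beta\in A'$ put $\delta_A(\alpha,\beta)=1$ if $z_A(\alpha)<v_A(\beta)$ and $\delta_A(\alpha,\beta)=0$ otherwise. For $\sigma\in S_r$ and $\alpha=a(i_1)+\cdots+a(i_s)\in A'$ (defining sum) put $\sigma(\alpha)=a(\sigma(i_1))+\cdots+a(\sigma(i_s))$. Let $A_N$ (resp. $A'_N$) be the set of positive integers congruent modulo $N$ to some element of $A$ (resp. $A'$), and let $\beta_N(m)\in\{1,\dots,N\}$ be the least positive residue of $m$ modulo $N$. An *overpartition* of $n$ is a finite multiset of positive integers with sum $n$ in which at most one occurrence of each integer may be overlined. For $\ell_1,\dots,\ell_r,k,n\ge 0$, let $\overline{D}(A_N;\ell_1,\dots,\ell_r;k,n)$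 be the number of overpartitions of $n$ into parts taken from $A_N$ having $k$ non-overlined parts and, for each $i\in\{1,\dots,r\}$, exactly $\ell_i$ parts congruent to $a(i)$ modulo $N$. For $\sigma\in S_r$, let $\overline{E}^{\sigma}(A'_N;\ell_1,\dots,\ell_r;k,n)$ be the number of overpartitions of $n$ into parts taken from $A'_N$ having $k$ non-overlined parts and, for each $i\in\{1,\dots,r\}$, exactly $\ell_i$ parts $m$ such that $\beta_N(m)$ uses $a(i)$ in its defining sum, whose parts can be listed in an order $\lambda_1,\dots,\lambda_s$ (not required to be weakly decreasing) satisfying, for all $1\le i<s$, $$\lambda_i-\lambda_{i+1}\ \ge\ N\Bigl(w_A(\beta_N(\lambda_{i+1}))-1+\chi(\overline{\lambda_{i+1}})+\delta_A\bigl(\sigma(\beta_N(\lambda_i)),\sigma(\beta_N(\lambda_{i+1}))\bigr)\Bigr)+\beta_N(\lambda_i)-\beta_N(\lambda_{i+1}),$$ where $\chi(\overline{\lambda_{i+1}})=1$ if $\lambda_{i+1}$ is overlined and $0$ otherwise. Then for all $\ell_1,\dots,\ell_r,k,n\ge 0$ and all $\sigma\in S_r$, $$\overline{D}(A_N;\ell_1,\dots,\ell_r;k,n)=\overline{E}^{\sigma}(A'_N;\ell_1,\dots,\ell_r;k,n).$$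 -/

import Mathlib

/-- `a(1), …, a(r)` satisfy `a(1) + ⋯ + a(k-1) < a(k)` for every `k`.
In particular all `a(k)` are positive and `a` is strictly increasing. -/
def Superincreasing {r : ℕ} (a : Fin r → ℕ) : Prop :=
  ∀ k : Fin r, ∑ i ∈ Finset.univ.filter (fun i => i < k), a i < a k

/-- The set `A'` of all sums of distinct elements of `A` (at least one summand). -/
def subsetSums {r : ℕ} (a : Fin r → ℕ) : Set ℕ :=
  {α | ∃ I : Finset (Fin r), I.Nonempty ∧ ∑ i ∈ I, a i = α}

/-- `A_N`: the positive integers congruent modulo `N` to some `a(i)`. -/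
def setAN {r : ℕ} (a : Fin r → ℕ) (N : ℕ) : Set ℕ :=
  {m | 0 < m ∧ ∃ i, m ≡ a i [MOD N]}

/-- `A'_N`: the positive integers congruent modulo `N` to some element of `A'`. -/
def setAN' {r : ℕ} (a : Fin r → ℕ) (N : ℕ) : Set ℕ :=
  {m | 0 < m ∧ ∃ α ∈ subsetSums a, m ≡ α [MOD N]}

/-- `β_N(m)`: the least positive residue of `m` modulo `N`, an element of `{1, …, N}`. -/
def leastPosResidue (N m : ℕ) : ℕ :=
  if m % N = 0 then N else m % N

open Classical in
/-- The set of indices `i` such that `a(i)` appears in the defining sum of `α ∈ A'`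
(`∅` if `α ∉ A'`). By `termIndices_sum` it does not depend on the choice made. -/
noncomputable def termIndices {r : ℕ} (a : Fin r → ℕ) (α : ℕ) : Finset (Fin r) :=
  if h : ∃ I : Finset (Fin r), I.Nonempty ∧ ∑ i ∈ I, a i = α then h.choose else ∅

/-- `w_A(α)`: the number of terms in the defining sum of `α`. -/
noncomputable def wA {r : ℕ} (a : Fin r → ℕ) (α : ℕ) : ℕ :=
  (termIndices a α).card

/-- `v_A(α)`: the smallest `a(i)` in the defining sum of `α`. -/
noncomputable def vA {r : ℕ} (a : Fin r → ℕ) (α : ℕ) : ℕ :=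
  sInf {x | ∃ i ∈ termIndices a α, a i = x}

/-- `z_A(α)`: the largest `a(i)` in the defining sum of `α`. -/
noncomputable def zA {r : ℕ} (a : Fin r → ℕ) (α : ℕ) : ℕ :=
  (termIndices a α).sup a

/-- `δ_A(α, β)` is `1` if `z_A(α) < v_A(β)` and `0` otherwise. -/
noncomputable def deltaA {r : ℕ} (a : Fin r → ℕ) (α β : ℕ) : ℕ :=
  if zA a α < vA a β then 1 else 0

/-- The action of a permutation on `A'`:
`σ(a(i₁) + ⋯ + a(iₛ)) = a(σ(i₁)) + ⋯ + a(σ(iₛ))`. -/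
noncomputable def permSum {r : ℕ} (a : Fin r → ℕ) (σ : Equiv.Perm (Fin r)) (α : ℕ) : ℕ :=
  ∑ i ∈ termIndices a α, a (σ i)

/-- `π` is an overpartition of `n`: a finite multiset of positive integers with sum `n`, in which
at most one occurrence of each integer is overlined. The pair `(m, true)` is an overlined part `m`,
the pair `(m, false)` a non-overlined part `m`. -/
structure IsOverpartition (n : ℕ) (π : Multiset (ℕ × Bool)) : Prop where
  pos : ∀ p ∈ π, 0 < p.1
  overlined_once : ∀ m, π.count (m, true) ≤ 1
  sum_eq : (π.map Prod.fst).sum = n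

/-- The number of non-overlined parts. -/
def numNonOverlined (π : Multiset (ℕ × Bool)) : ℕ :=
  π.countP (fun p => p.2 = false)

/-- The indicator `χ` of overlined parts. -/
def chi (p : ℕ × Bool) : ℕ := if p.2 = true then 1 else 0

/-- The difference condition between a part `x = λ_i` and the next one `y = λ_{i+1}`. -/
def DiffCond {r : ℕ} (a : Fin r → ℕ) (N : ℕ) (σ : Equiv.Perm (Fin r)) (x y : ℕ × Bool) : Prop :=
  (x.1 : ℤ) - (y.1 : ℤ) ≥
    (N : ℤ) * ((wA a (leastPosResidue N y.1) : ℤ) - 1 + (chi y : ℤ) +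
      (deltaA a (permSum a σ (leastPosResidue N x.1))
        (permSum a σ (leastPosResidue N y.1)) : ℤ))
    + (leastPosResidue N x.1 : ℤ) - (leastPosResidue N y.1 : ℤ)

/-- The overpartitions of `n` into parts from `A_N` with `k` non-overlined parts and, for each `i`,
exactly `ℓ i` parts congruent to `a(i)` modulo `N`. -/
def setD {r : ℕ} (a : Fin r → ℕ) (N : ℕ) (ℓ : Fin r → ℕ) (k n : ℕ) :
    Set (Multiset (ℕ × Bool)) :=
  {π | IsOverpartition n π ∧ (∀ p ∈ π, p.1 ∈ setAN a N) ∧ numNonOverlined π = k ∧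
    ∀ i, π.countP (fun p => p.1 ≡ a i [MOD N]) = ℓ i}

/-- The overpartitions of `n` into parts from `A'_N` with `k` non-overlined parts such that, for
each `i`, exactly `ℓ i` parts `m` are such that `β_N(m)` uses `a(i)` in its defining sum, and whose
parts can be listed as `λ_1, …, λ_s` so that any two consecutive ones satisfy the difference
condition. The right-hand side of that condition can be negative when `σ` is not the identity, so
the listing is fixed by the condition itself and need not be weakly decreasing. For instance, with
`a = (1, 2)`, `N = 3` and `σ` the transposition, `λ_1 = 1, λ_2 = 2` (both non-overlined) is
admissible, the required difference being `-1`. -/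
def setE {r : ℕ} (a : Fin r → ℕ) (N : ℕ) (σ : Equiv.Perm (Fin r)) (ℓ : Fin r → ℕ) (k n : ℕ) :
    Set (Multiset (ℕ × Bool)) :=
  {π | IsOverpartition n π ∧ (∀ p ∈ π, p.1 ∈ setAN' a N) ∧ numNonOverlined π = k ∧
    (∀ i, π.countP (fun p => i ∈ termIndices a (leastPosResidue N p.1)) = ℓ i) ∧
    ∃ l : List (ℕ × Bool), (l : Multiset (ℕ × Bool)) = π ∧ l.IsChain (DiffCond a N σ)}

/-- There are finitely many overpartitions of `n`, so that counting them by `Set.ncard` is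
meaningful. -/
theorem finite_isOverpartition (n : ℕ) : {π | IsOverpartition n π}.Finite := by
  refine (Set.finite_Iic (n • (Finset.range (n + 1) ×ˢ (Finset.univ : Finset Bool)).val)).subset ?_
  intro π hπ
  obtain ⟨hpos, -, hsum⟩ := hπ
  have hcard : π.card ≤ n := by
    have h : (π.map Prod.fst).card • 1 ≤ (π.map Prod.fst).sum :=
      Multiset.card_nsmul_le_sum (fun x hx => by
        obtain ⟨p, hp, rfl⟩ := Multiset.mem_map.1 hx
        exact hpos p hp)
    simpa [hsum] using h
  rw [Set.mem_Iic, Multiset.le_iff_count]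
  intro p
  by_cases hp : p ∈ π
  · have h1 : p.1 ≤ n := by
      rw [← hsum]
      exact Multiset.single_le_sum (fun _ _ => Nat.zero_le _) _ (Multiset.mem_map_of_mem _ hp)
    have h2 : (Finset.range (n + 1) ×ˢ (Finset.univ : Finset Bool)).val.count p = 1 :=
      Multiset.count_eq_one_of_mem (Finset.nodup _)
        (by
          have : p ∈ Finset.range (n + 1) ×ˢ (Finset.univ : Finset Bool) := by
            simp [Finset.mem_product]; omega
          exact this)
    rw [Multiset.count_nsmul, h2, mul_one]
    exact (Multiset.count_le_card _ _).trans hcard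
  · rw [Multiset.count_eq_zero_of_notMem hp]
    exact Nat.zero_le _

/-- Sums of distinct elements of a superincreasing family determine the summands. -/
theorem Superincreasing.sum_injective {r : ℕ} {a : Fin r → ℕ} (ha : Superincreasing a)
    {I J : Finset (Fin r)} (h : ∑ i ∈ I, a i = ∑ i ∈ J, a i) : I = J := by
  have key : ∀ I J : Finset (Fin r), ∀ m, m ∈ I → m ∉ J →
      (∀ j, m < j → (j ∈ I ↔ j ∈ J)) → ∑ i ∈ J, a i < ∑ i ∈ I, a i := by
    intro I J m hI hJ hm
    have e : J.filter (fun i => m < i) = I.filter (fun i => m < i) := by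
      ext j
      simp only [Finset.mem_filter]
      constructor
      · rintro ⟨h1, h2⟩; exact ⟨(hm j h2).2 h1, h2⟩
      · rintro ⟨h1, h2⟩; exact ⟨(hm j h2).1 h1, h2⟩
    rw [← Finset.sum_filter_add_sum_filter_not J (fun i => m < i),
      ← Finset.sum_filter_add_sum_filter_not I (fun i => m < i), e]
    have h1 : ∑ i ∈ J.filter (fun i => ¬ m < i), a i
        ≤ ∑ i ∈ Finset.univ.filter (fun i => i < m), a i := by
      apply Finset.sum_le_sum_of_subset
      intro j hj
      simp only [Finset.mem_filter, Finset.mem_univ, true_and, not_lt] at hj ⊢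
      exact lt_of_le_of_ne hj.2 (fun hh => hJ (hh ▸ hj.1))
    have h2 : a m ≤ ∑ i ∈ I.filter (fun i => ¬ m < i), a i :=
      Finset.single_le_sum (f := a) (fun _ _ => Nat.zero_le _) (by simp [hI])
    have h3 := ha m
    omega
  by_contra hne
  have hD : (symmDiff I J).Nonempty := by
    rw [Finset.nonempty_iff_ne_empty]
    intro h0
    exact hne (symmDiff_eq_bot.1 h0)
  have hmem := Finset.max'_mem _ hD
  have hout : ∀ j, (symmDiff I J).max' hD < j → (j ∈ I ↔ j ∈ J) := by
    intro j hj
    by_contra hc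
    have : j ∈ symmDiff I J := by
      rw [Finset.mem_symmDiff]; tauto
    exact absurd (Finset.le_max' _ _ this) (not_le.2 hj)
  rcases Finset.mem_symmDiff.1 hmem with ⟨h1, h2⟩ | ⟨h1, h2⟩
  · exact absurd h (ne_of_gt (key I J _ h1 h2 hout))
  · exact absurd h (ne_of_lt (key J I _ h1 h2 (fun j hj => (hout j hj).symm)))

/-- The indices of the defining sum of `∑ i ∈ I, a i` are the elements of `I`. -/
theorem termIndices_sum {r : ℕ} {a : Fin r → ℕ} (ha : Superincreasing a)
    {I : Finset (Fin r)} (hI : I.Nonempty) : termIndices a (∑ i ∈ I, a i) = I := by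
  have h : ∃ K : Finset (Fin r), K.Nonempty ∧ ∑ i ∈ K, a i = ∑ i ∈ I, a i := ⟨I, hI, rfl⟩
  rw [termIndices, dif_pos h]
  exact ha.sum_injective h.choose_spec.2

/-! Write a part as N·s plus its least positive residue, and colour it by the set C of indices of
its defining sum, moved by σ. The counts ℓ fix the total of all residues, so only the sizes s and
the overlining remain. From the smallest part up, the difference condition reads s' ≥ s + (|C| - 1)
+ δ + χ, where δ = 1 exactly when all indices of the next colour set are below all those of C
(`diffCond_encode`). Let q mark the sum of the sizes and d the number of non-overlined parts.

For a fixed word W of colour sets the forced gaps cost q^`wordStat W`. Beyond them, a part with j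
larger parts is either plain (factor d) or overlined, which pushes up those j parts (factor q^j); a
free gap moves j+1 parts (factor 1/(1-q^(j+1))). So lists coloured W have generating function
q^`wordStat W` · O_m, with m = |W| and O_m = ∏_{j<m} (d+q^j)/(1-q^(j+1)) (`isGF_chains`). On the D
side, the parts of colour c form a word of ℓ_c equal singletons with no forced gap, and the colours
are independent: this gives ∏ O_{ℓ_c}, which is symmetric in the colours, so σ does not matter. The
theorem becomes ∑_W q^`wordStat W` · O_{|W|} = ∏ O_{ℓ_c}, over words W of content ℓ
(`finsum_words_overGF`).

Both sides are polynomials in d, so it suffices to take d = -q^n for all n; then O_m becomes the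
elementary symmetric polynomial e_m(1, q, …, q^(n-1)) (`eval_overGF`). The product of these
enumerates sets of pairs (y, c) with y < n and ℓ_c pairs of colour c. Removing the lexicographically
largest pair corresponds to deleting the largest letter of the first block of W, and induction on
the total content applies (`finsum_words_ite`). -/

/-! ### Generating functions in two statistics -/

/-- `p = ∑ coeff · d ^ K * q ^ M` is the generating function of the elements of `S`, the statistic
`k` being marked by the polynomial variable and `T` by the variable of the power series. -/
structure IsGF {α : Type*} (S : Set α) (k T : α → ℕ) (p : Polynomial (PowerSeries ℤ)) : Prop where
  finite : ∀ K M, {x | x ∈ S ∧ k x = K ∧ T x = M}.Finite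
  ncard_eq : ∀ K M, ({x | x ∈ S ∧ k x = K ∧ T x = M}.ncard : ℤ) = PowerSeries.coeff M (p.coeff K)

namespace IsGF

variable {α β : Type*} {S : Set α} {S' : Set β} {k T : α → ℕ} {k' T' : β → ℕ}
  {p p' : Polynomial (PowerSeries ℤ)}

theorem prod (h : IsGF S k T p) (h' : IsGF S' k' T' p') :
    IsGF (S ×ˢ S') (fun x => k x.1 + k' x.2) (fun x => T x.1 + T' x.2) (p * p') := by
  have key : ∀ K M, ∃ F : Finset (α × β),
      (↑F : Set (α × β)) = {x | x ∈ S ×ˢ S' ∧ k x.1 + k' x.2 = K ∧ T x.1 + T' x.2 = M} ∧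
      (F.card : ℤ) = PowerSeries.coeff M ((p * p').coeff K) := by
    classical
    intro K M
    set t := Finset.HasAntidiagonal.antidiagonal K ×ˢ
      Finset.HasAntidiagonal.antidiagonal M with ht
    set G : (ℕ × ℕ) × (ℕ × ℕ) → Finset (α × β) := fun j =>
      (h.finite j.1.1 j.2.1).toFinset ×ˢ (h'.finite j.1.2 j.2.2).toFinset with hG
    have memG : ∀ j x, x ∈ G j ↔ (x.1 ∈ S ∧ k x.1 = j.1.1 ∧ T x.1 = j.2.1) ∧
        (x.2 ∈ S' ∧ k' x.2 = j.1.2 ∧ T' x.2 = j.2.2) := by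
      intro j x; simp [hG, Finset.mem_product]; tauto
    refine ⟨t.biUnion G, ?_, ?_⟩
    · ext x
      simp only [Finset.mem_coe, Finset.mem_biUnion, memG, Set.mem_ofPred_eq, Set.mem_prod]
      constructor
      · rintro ⟨j, hj, ⟨h1, h2, h3⟩, h4, h5, h6⟩
        simp only [ht, Finset.mem_product, Finset.HasAntidiagonal.mem_antidiagonal] at hj
        exact ⟨⟨h1, h4⟩, by omega, by omega⟩
      · rintro ⟨⟨h1, h2⟩, h3, h4⟩
        refine ⟨((k x.1, k' x.2), (T x.1, T' x.2)), ?_, ⟨h1, rfl, rfl⟩, h2, rfl, rfl⟩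
        simp [ht, Finset.mem_product, Finset.HasAntidiagonal.mem_antidiagonal, h3, h4]
    · rw [Finset.card_biUnion]
      · rw [Polynomial.coeff_mul, map_sum, ht, Finset.sum_product]
        push_cast
        refine Finset.sum_congr rfl fun i _ => ?_
        rw [PowerSeries.coeff_mul]
        refine Finset.sum_congr rfl fun j _ => ?_
        rw [hG, Finset.card_product, ← h.ncard_eq, ← h'.ncard_eq,
          Set.ncard_eq_toFinset_card _ (h.finite _ _), Set.ncard_eq_toFinset_card _ (h'.finite _ _)]
        push_cast
        rfl
      · intro i _ j _ hij
        rw [Function.onFun, Finset.disjoint_left]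
        intro x hx hx'
        rw [memG] at hx hx'
        apply hij
        ext <;> omega
  refine ⟨fun K M => ?_, fun K M => ?_⟩ <;> obtain ⟨F, h1, h2⟩ := key K M
  · rw [← h1]; exact F.finite_toSet
  · rw [← h1, Set.ncard_coe_finset, h2]

theorem image (h : IsGF S k T p) (f : α → β) (hf : Set.InjOn f S) (b : ℕ)
    (hk : ∀ x ∈ S, k' (f x) = k x) (hT : ∀ x ∈ S, T' (f x) = T x + b) :
    IsGF (f '' S) k' T' (Polynomial.C (PowerSeries.X ^ b) * p) := by
  have key : ∀ K M, {y | y ∈ f '' S ∧ k' y = K ∧ T' y = M} =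
      f '' {x | x ∈ S ∧ k x = K ∧ T x + b = M} := by
    intro K M
    ext y
    constructor
    · rintro ⟨⟨x, hx, rfl⟩, h1, h2⟩
      exact ⟨x, ⟨hx, by rw [← hk x hx, h1], by rw [← hT x hx, h2]⟩, rfl⟩
    · rintro ⟨x, ⟨hx, h1, h2⟩, rfl⟩
      exact ⟨⟨x, hx, rfl⟩, by rw [hk x hx, h1], by rw [hT x hx, h2]⟩
  have key2 : ∀ K M, b ≤ M → {x | x ∈ S ∧ k x = K ∧ T x + b = M} =
      {x | x ∈ S ∧ k x = K ∧ T x = M - b} := by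
    intro K M hb; ext x; simp only [Set.mem_ofPred_eq]
    constructor <;> rintro ⟨h1, h2, h3⟩ <;> exact ⟨h1, h2, by omega⟩
  have key3 : ∀ K M, ¬ b ≤ M → {x | x ∈ S ∧ k x = K ∧ T x + b = M} = ∅ := by
    intro K M hb; ext x; simp only [Set.mem_ofPred_eq, Set.mem_empty_iff_false, iff_false]
    rintro ⟨_, _, h3⟩; omega
  refine ⟨fun K M => ?_, fun K M => ?_⟩
  · rw [key]
    by_cases hb : b ≤ M
    · rw [key2 K M hb]; exact (h.finite _ _).image _
    · rw [key3 K M hb]; simp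
  · rw [key, Set.InjOn.ncard_image (hf.mono fun x hx => hx.1), Polynomial.coeff_C_mul,
      PowerSeries.coeff_X_pow_mul']
    by_cases hb : b ≤ M
    · rw [key2 K M hb, if_pos hb, h.ncard_eq]
    · rw [key3 K M hb, if_neg hb]; simp

theorem biUnion {ι : Type*} (s : Finset ι) (S : ι → Set α) (P : ι → Polynomial (PowerSeries ℤ))
    (h : ∀ i ∈ s, IsGF (S i) k T (P i))
    (hd : ∀ i ∈ s, ∀ j ∈ s, ∀ x, x ∈ S i → x ∈ S j → i = j) :
    IsGF (⋃ i ∈ s, S i) k T (∑ i ∈ s, P i) := by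
  have key : ∀ K M, {x | x ∈ (⋃ i ∈ s, S i) ∧ k x = K ∧ T x = M} =
      ⋃ i ∈ s, {x | x ∈ S i ∧ k x = K ∧ T x = M} := by
    intro K M; ext x
    simp only [Set.mem_ofPred_eq, Set.mem_iUnion, exists_prop]
    constructor
    · rintro ⟨⟨i, hi, hx⟩, h1⟩; exact ⟨i, hi, hx, h1⟩
    · rintro ⟨i, hi, hx, h1⟩; exact ⟨⟨i, hi, hx⟩, h1⟩
  refine ⟨fun K M => ?_, fun K M => ?_⟩
  · rw [key]
    exact Set.Finite.biUnion s.finite_toSet fun i hi => (h i hi).finite K M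
  · rw [key]
    classical
    induction s using Finset.induction_on with
    | empty => simp
    | insert i s hi ih =>
      have hfin : (⋃ j ∈ s, {x | x ∈ S j ∧ k x = K ∧ T x = M}).Finite :=
        Set.Finite.biUnion s.finite_toSet
          fun j hj => (h j (Finset.mem_insert_of_mem hj)).finite K M
      rw [Finset.set_biUnion_insert, Set.ncard_union_eq _ ((h i (by simp)).finite K M) hfin,
        Finset.sum_insert hi, Polynomial.coeff_add, map_add, ← (h i (by simp)).ncard_eq]
      · push_cast
        rw [ih (fun j hj => h j (Finset.mem_insert_of_mem hj))
          (fun a ha b hb => hd a (Finset.mem_insert_of_mem ha) b (Finset.mem_insert_of_mem hb))]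
        all_goals
          intro K M; ext x
          simp only [Set.mem_ofPred_eq, Set.mem_iUnion, exists_prop]
          tauto
      · rw [Set.disjoint_left]
        intro x hx hx'
        simp only [Set.mem_iUnion, exists_prop] at hx'
        obtain ⟨j, hj, hxj⟩ := hx'
        exact hi (hd i (by simp) j (Finset.mem_insert_of_mem hj) x hx.1 hxj.1 ▸ hj)

theorem singleton (x : α) (hk : k x = 0) (hT : T x = 0) : IsGF {x} k T 1 := by
  have key : ∀ K M, {y | y ∈ ({x} : Set α) ∧ k y = K ∧ T y = M} =
      if K = 0 ∧ M = 0 then {x} else ∅ := by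
    intro K M
    split_ifs with h
    · ext y
      simp only [Set.mem_ofPred_eq, Set.mem_singleton_iff]
      constructor
      · exact fun h => h.1
      · rintro rfl; exact ⟨rfl, by omega, by omega⟩
    · ext y
      simp only [Set.mem_ofPred_eq, Set.mem_singleton_iff, Set.mem_empty_iff_false, iff_false]
      rintro ⟨rfl, h1, h2⟩; exact h (by omega)
  refine ⟨fun K M => (Set.finite_singleton x).subset fun y hy => hy.1, fun K M => ?_⟩
  rw [key, Polynomial.coeff_one]
  by_cases hK : K = 0 <;> by_cases hM : M = 0 <;> simp [hK, hM, PowerSeries.coeff_one]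

theorem pi {r : ℕ} {S : Fin r → Set α} {P : Fin r → Polynomial (PowerSeries ℤ)}
    (h : ∀ i, IsGF (S i) k T (P i)) :
    IsGF {g : Fin r → α | ∀ i, g i ∈ S i} (fun g => ∑ i, k (g i)) (fun g => ∑ i, T (g i))
      (∏ i, P i) := by
  induction r with
  | zero =>
    have : {g : Fin 0 → α | ∀ i, g i ∈ S i} = {Fin.elim0} := by
      ext g; simp [Subsingleton.elim g Fin.elim0]
    rw [this]
    simpa using singleton (k := fun g : Fin 0 → α => ∑ i, k (g i))
      (T := fun g : Fin 0 → α => ∑ i, T (g i)) Fin.elim0 (by simp) (by simp)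
  | succ r ih =>
    have h1 := (h 0).prod (ih (S := fun i => S i.succ) fun i => h i.succ)
    have h2 := h1.image (fun x => (Fin.cons x.1 x.2 : Fin (r + 1) → α))
      (k' := fun g => ∑ i, k (g i)) (T' := fun g => ∑ i, T (g i))
      (fun x _ y _ hxy => by
        obtain ⟨h1, h2⟩ := Fin.cons_inj.1 hxy
        exact Prod.ext h1 h2) 0
      (fun x _ => by simp [Fin.sum_univ_succ]) (fun x _ => by simp [Fin.sum_univ_succ])
    rw [Fin.prod_univ_succ]
    simp only [pow_zero, map_one, one_mul] at h2
    convert h2 using 1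
    ext g
    constructor
    · intro hg
      exact ⟨(g 0, Fin.tail g), ⟨hg 0, fun i => hg i.succ⟩, Fin.cons_self_tail g⟩
    · rintro ⟨x, ⟨hx, hx'⟩, rfl⟩ i
      refine Fin.cases ?_ (fun j => ?_) i
      · simpa using hx
      · simpa using hx' j

/-- The form in which equal generating functions are used: n is N times the sum of sizes plus a
constant c. If n is not of this form, both sets are empty. -/
theorem ncard_eq_ncard (h : IsGF S k T p) (h' : IsGF S' k' T' p) {N : ℕ} (hN : 0 < N) (c K n : ℕ) :
    {x | x ∈ S ∧ k x = K ∧ N * T x + c = n}.ncard =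
      {x | x ∈ S' ∧ k' x = K ∧ N * T' x + c = n}.ncard := by
  by_cases hn : ∃ M, N * M + c = n
  · obtain ⟨M, rfl⟩ := hn
    simp only [Nat.add_right_cancel_iff, Nat.mul_right_inj hN.ne']
    have := (h.ncard_eq K M).trans (h'.ncard_eq K M).symm
    exact_mod_cast this
  · push Not at hn
    simp [hn]

end IsGF

/-! ### Overpartitions with a given number of parts -/

theorem one_sub_X_pow_mul_mk_dvd {m : ℕ} (hm : 0 < m) :
    (1 - PowerSeries.X ^ m : PowerSeries ℤ) * PowerSeries.mk (fun n => if m ∣ n then 1 else 0) = 1 := by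
  ext n
  rw [sub_mul, one_mul, map_sub, PowerSeries.coeff_X_pow_mul', PowerSeries.coeff_mk,
    PowerSeries.coeff_one]
  by_cases hn : m ≤ n
  · obtain ⟨n', rfl⟩ := Nat.exists_eq_add_of_le hn
    rw [if_pos hn, PowerSeries.coeff_mk, if_neg (by omega : ¬ m + n' = 0), Nat.add_sub_cancel_left]
    simp
  · rw [if_neg hn, sub_zero]
    by_cases h : n = 0
    · simp [h]
    · rw [if_neg h, if_neg fun hd => hn (Nat.le_of_dvd (Nat.pos_of_ne_zero h) hd)]

/-- The generating function of overpartitions into `m` parts, all of them at least `0`. -/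
noncomputable def overGF (m : ℕ) : Polynomial (PowerSeries ℤ) :=
  ∏ j ∈ Finset.range m, ((Polynomial.X + Polynomial.C (PowerSeries.X ^ j)) *
    Polynomial.C (PowerSeries.mk fun n => if j + 1 ∣ n then 1 else 0))

/-- The choices available to a part with `m` larger parts above it: overlining raises those `m` by
one, and a free gap raises all `m + 1`. -/
theorem isGF_bool_nat (m : ℕ) :
    IsGF (Set.univ : Set (Bool × ℕ)) (fun x => if x.1 then 0 else 1)
      (fun x => m * (if x.1 then 1 else 0) + (m + 1) * x.2)
      ((Polynomial.X + Polynomial.C (PowerSeries.X ^ m)) *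
        Polynomial.C (PowerSeries.mk fun n => if m + 1 ∣ n then 1 else 0)) := by
  have h1 : IsGF (Set.univ : Set Bool) (fun x => if x then 0 else 1)
      (fun x => m * (if x then 1 else 0))
      (Polynomial.X + Polynomial.C (PowerSeries.X ^ m)) := by
    refine ⟨fun K M => Set.toFinite _, fun K M => ?_⟩
    classical
    rw [Set.ncard_eq_toFinset_card']
    simp only [Set.mem_univ, true_and, Set.toFinset_ofPred]
    rw [show (Finset.univ : Finset Bool) = {true, false} from rfl, Finset.filter_insert,
      Finset.filter_singleton, Polynomial.coeff_add, Polynomial.coeff_X, Polynomial.coeff_C, map_add]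
    by_cases hK : K = 0
    · subst hK
      simp [PowerSeries.coeff_X_pow, eq_comm (a := m)]
      split_ifs <;> simp
    · by_cases hK1 : 1 = K
      · subst hK1
        simp [PowerSeries.coeff_one, eq_comm (a := M)]
        split_ifs <;> simp
      · simp [hK, hK1, Ne.symm hK]
  have h2 : IsGF (Set.univ : Set ℕ) (fun _ => 0) (fun x => (m + 1) * x)
      (Polynomial.C (PowerSeries.mk fun n => if m + 1 ∣ n then 1 else 0)) := by
    have key : ∀ K M, {x | x ∈ (Set.univ : Set ℕ) ∧ 0 = K ∧ (m + 1) * x = M} =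
        if K = 0 ∧ m + 1 ∣ M then {M / (m + 1)} else ∅ := by
      intro K M
      ext x
      split_ifs with h
      · obtain ⟨rfl, y, rfl⟩ := h
        simp
      · simp only [Set.mem_ofPred_eq, Set.mem_univ, true_and, Set.mem_empty_iff_false, iff_false]
        rintro ⟨rfl, rfl⟩
        exact h ⟨rfl, dvd_mul_right _ _⟩
    refine ⟨fun K M => ?_, fun K M => ?_⟩
    · rw [key]; split_ifs <;> simp
    · rw [key, Polynomial.coeff_C]
      by_cases hK : K = 0 <;> by_cases hM : m + 1 ∣ M <;> simp [hK, hM]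
  have h3 := h1.prod h2
  rwa [Set.univ_prod_univ] at h3

/-! ### Elementary symmetric polynomials in powers of q -/

/-- The elementary symmetric polynomial `e_m(1, q, …, q ^ (n - 1))`. -/
def qEsymm {R : Type*} [CommRing R] (q : R) : ℕ → ℕ → R
  | 0, _ => 1
  | _ + 1, 0 => 0
  | m + 1, n + 1 => qEsymm q (m + 1) n + q ^ n * qEsymm q m n

section qEsymm
variable {R : Type*} [CommRing R] (q : R)

@[simp] theorem qEsymm_zero (n : ℕ) : qEsymm q 0 n = 1 := by cases n <;> rfl

@[simp] theorem qEsymm_succ_zero (m : ℕ) : qEsymm q (m + 1) 0 = 0 := rfl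

theorem qEsymm_succ_succ (m n : ℕ) :
    qEsymm q (m + 1) (n + 1) = qEsymm q (m + 1) n + q ^ n * qEsymm q m n := rfl

/-- The dual Pascal rule: here the variable 1 is split off instead of q^n, and the other variables
are q times 1, …, q^(n-1). -/
theorem qEsymm_succ_succ' (m n : ℕ) :
    qEsymm q (m + 1) (n + 1) = q ^ (m + 1) * qEsymm q (m + 1) n + q ^ m * qEsymm q m n := by
  induction n generalizing m with
  | zero => cases m <;> simp [qEsymm_succ_succ]
  | succ n ih =>
    rw [qEsymm_succ_succ]
    cases m with
    | zero =>
      have h1 := ih 0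
      simp only [qEsymm_zero] at h1 ⊢
      linear_combination h1 - q * qEsymm_succ_succ q 0 n - q * q ^ n * qEsymm_zero q n
    | succ m =>
      linear_combination ih (m + 1) + q ^ (n + 1) * ih m
        - q ^ (m + 2) * qEsymm_succ_succ q (m + 1) n - q ^ (m + 1) * qEsymm_succ_succ q m n

/-- Obtained by comparing the two Pascal rules. This is the recurrence satisfied by `overGF` at d =
-q^n. -/
theorem qEsymm_rec (m n : ℕ) :
    (1 - q ^ (m + 1)) * qEsymm q (m + 1) n = (q ^ m - q ^ n) * qEsymm q m n := by
  have h := qEsymm_succ_succ q m n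
  rw [qEsymm_succ_succ'] at h
  linear_combination -h

/-- Here q^y is the largest variable occurring in a monomial. -/
theorem sum_mul_qEsymm (m n : ℕ) :
    ∑ y ∈ Finset.range n, q ^ y * qEsymm q m y = qEsymm q (m + 1) n := by
  induction n with
  | zero => simp
  | succ n ih => rw [Finset.sum_range_succ, ih, qEsymm_succ_succ]

theorem sum_mul_qEsymm_succ (m n : ℕ) :
    ∑ y ∈ Finset.range n, q ^ y * qEsymm q (m + 1) (y + 1) =
      q ^ (m + 1) * qEsymm q (m + 2) n + q ^ m * qEsymm q (m + 1) n := by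
  rw [← sum_mul_qEsymm, ← sum_mul_qEsymm, Finset.mul_sum, Finset.mul_sum, ← Finset.sum_add_distrib]
  refine Finset.sum_congr rfl fun y _ => ?_
  rw [qEsymm_succ_succ']; ring

/-- Both sides collect the monomials that contain q^n; the guard discards the truncated value of `m
- 1` at `m = 0`. -/
theorem mul_qEsymm_pred (m n : ℕ) :
    (if 0 < m then q ^ n * qEsymm q (m - 1) n else 0) = qEsymm q m (n + 1) - qEsymm q m n := by
  cases m with
  | zero => simp
  | succ m => simp [qEsymm_succ_succ]

end qEsymm

/-! ### Words in colour sets and their product formula -/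

section words
variable {ι : Type*} [LinearOrder ι]

/-- The first block of `W` exists and all its letters are smaller than `c`. -/
def HeadBelow : List (Finset ι) → ι → Prop
  | [], _ => False
  | B :: _, c => ∀ i ∈ B, i < c

open Classical in
/-- The least difference, overlining apart, between a part coloured `C` and the next larger part,
the colours of the larger parts being listed by `W`. -/
noncomputable def jump (C : Finset ι) (W : List (Finset ι)) : ℕ :=
  C.card - 1 + if ∀ j ∈ C, HeadBelow W j then 1 else 0

/-- The sum of the parts of the smallest non-overlined partition coloured `W`. -/
noncomputable def wordStat : List (Finset ι) → ℕ
  | [] => 0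
  | C :: W => W.length * jump C W + wordStat W

variable (ι) in
/-- The number of blocks of `W` that contain `i`. -/
def content (W : List (Finset ι)) (i : ι) : ℕ := W.countP (fun C => i ∈ C)

/-- The words in nonempty blocks with content `ℓ`. -/
def words (ℓ : ι → ℕ) : Set (List (Finset ι)) :=
  {W | (∀ C ∈ W, C.Nonempty) ∧ content ι W = ℓ}

theorem content_cons (C : Finset ι) (W : List (Finset ι)) :
    content ι (C :: W) = content ι W + fun i => if i ∈ C then 1 else 0 := by
  ext i; simp [content, List.countP_cons]

theorem sum_content [Fintype ι] (W : List (Finset ι)) :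
    ∑ i, content ι W i = (W.map Finset.card).sum := by
  induction W with
  | nil => simp [content]
  | cons C W ih => rw [content_cons]; simp [Finset.sum_add_distrib, ih, add_comm]

theorem finite_words [Fintype ι] (ℓ : ι → ℕ) : (words ℓ).Finite := by
  refine (List.finite_length_le (Finset ι) (∑ i, ℓ i)).subset ?_
  rintro W ⟨hW, rfl⟩
  rw [Set.mem_ofPred_eq, sum_content]
  induction W with
  | nil => simp
  | cons C W ih =>
    have := ih fun C hC => hW C (by simp [hC])
    have := (hW C (by simp)).card_pos
    simp; omega

theorem words_zero : words (0 : ι → ℕ) = {[]} := by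
  ext W
  constructor
  · rintro ⟨h1, h2⟩
    cases W with
    | nil => rfl
    | cons C W =>
      obtain ⟨i, hi⟩ := h1 C (by simp)
      have := congrFun h2 i
      simp [content_cons, hi] at this
  · rintro rfl
    exact ⟨by simp, by ext; simp [content]⟩

theorem jump_singleton_of_headBelow {c : ι} {W : List (Finset ι)} (h : HeadBelow W c) :
    jump {c} W = 1 := by simp [jump, h]

theorem jump_singleton_of_not_headBelow {c : ι} {W : List (Finset ι)} (h : ¬ HeadBelow W c) :
    jump {c} W = 0 := by simp [jump, h]

theorem HeadBelow.trans {W : List (Finset ι)} {b c : ι} (h : HeadBelow W b) (hbc : b < c) :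
    HeadBelow W c := by
  cases W with
  | nil => exact h
  | cons B W => exact fun i hi => (h i hi).trans hbc

/-- A letter above `B` does not change the minimum of the block, which alone decides the indicator
in `jump`. -/
theorem jump_insert {c : ι} {B : Finset ι} {W : List (Finset ι)} (hB : B.Nonempty)
    (hc : ∀ i ∈ B, i < c) : jump (insert c B) W = jump B W + 1 := by
  classical
  have hcB : c ∉ B := fun h => (hc c h).false
  have hiff : (∀ j ∈ insert c B, HeadBelow W j) ↔ ∀ j ∈ B, HeadBelow W j := by
    constructor
    · intro h j hj; exact h j (by simp [hj])
    · intro h j hj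
      rcases Finset.mem_insert.1 hj with rfl | hj
      · obtain ⟨b, hb⟩ := hB
        exact (h b hb).trans (hc b hb)
      · exact h j hj
  have := hB.card_pos
  rw [jump, jump, Finset.card_insert_of_notMem hcB, if_congr hiff rfl rfl]
  omega

/-- Words whose first block has maximum `c`. -/
def wordsMax (ℓ : ι → ℕ) (c : ι) : Set (List (Finset ι)) :=
  {W | W ∈ words ℓ ∧ ∃ C V, W = C :: V ∧ c ∈ C ∧ ∀ i ∈ C, i ≤ c}

/-- Adding the letter `c` to the first block. -/
def insertHead (c : ι) : List (Finset ι) → List (Finset ι)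
  | [] => []
  | B :: V => insert c B :: V

/-- Deleting the maximum `c` of the first block either removes that block or leaves a nonempty block
below `c`. -/
theorem wordsMax_add_single (ℓ : ι → ℕ) (c : ι) :
    wordsMax (ℓ + Pi.single c 1) c =
      (fun V => {c} :: V) '' words ℓ ∪ insertHead c '' {V | V ∈ words ℓ ∧ HeadBelow V c} := by
  have e1 : (fun i => if i ∈ ({c} : Finset ι) then 1 else 0) = (Pi.single c 1 : ι → ℕ) := by
    ext i; simp [Pi.single_apply]
  have e2 : ∀ B : Finset ι, c ∉ B → (fun i => if i ∈ insert c B then 1 else 0) =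
      (fun i => if i ∈ B then 1 else 0) + (Pi.single c 1 : ι → ℕ) := by
    intro B hB
    ext i
    by_cases h : i = c
    · subst h; simp [hB]
    · simp [h]
  ext W
  constructor
  · rintro ⟨⟨h1, h2⟩, C, V, rfl, hc, hle⟩
    by_cases hC : C = {c}
    · subst hC
      refine Or.inl ⟨V, ⟨fun C hC => h1 C (by simp [hC]), ?_⟩, rfl⟩
      rw [content_cons, e1] at h2
      exact add_right_cancel h2
    · have hne : (C.erase c).Nonempty := by
        rw [Finset.nonempty_iff_ne_empty]
        intro h
        rw [Finset.erase_eq_empty_iff] at h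
        rcases h with rfl | h
        · simp at hc
        · exact hC h
      refine Or.inr ⟨C.erase c :: V, ⟨⟨?_, ?_⟩, ?_⟩, ?_⟩
      · intro D hD
        rcases List.mem_cons.1 hD with rfl | hD
        · exact hne
        · exact h1 D (by simp [hD])
      · rw [← Finset.insert_erase hc, content_cons, e2 _ (Finset.notMem_erase c C), ← add_assoc] at h2
        rw [content_cons]
        exact add_right_cancel h2
      · intro i hi
        exact lt_of_le_of_ne (hle i (Finset.mem_of_mem_erase hi)) (Finset.ne_of_mem_erase hi)
      · simp [insertHead, Finset.insert_erase hc]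
  · rintro (⟨V, ⟨h1, h2⟩, rfl⟩ | ⟨V, ⟨⟨h1, h2⟩, h3⟩, rfl⟩)
    · refine ⟨⟨?_, ?_⟩, {c}, V, rfl, by simp, by simp⟩
      · intro D hD
        rcases List.mem_cons.1 hD with rfl | hD
        · simp
        · exact h1 D hD
      · rw [content_cons, h2, e1]
    · cases V with
      | nil => exact h3.elim
      | cons B V =>
        have hcB : c ∉ B := fun h => (h3 c h).false
        refine ⟨⟨?_, ?_⟩, insert c B, V, rfl, by simp, ?_⟩
        · intro D hD
          rcases List.mem_cons.1 hD with rfl | hD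
          · simp
          · exact h1 D (by simp [hD])
        · rw [insertHead, content_cons, e2 B hcB, ← add_assoc, ← content_cons, h2]
        · intro i hi
          rcases Finset.mem_insert.1 hi with rfl | hi
          · rfl
          · exact (h3 i hi).le

variable {R : Type*} [CommRing R] (q : R)

/-- The left-hand side of the induction: deleting the letter `c` corresponds to removing a pair (y,
c). What remains may use height y too exactly when its first block lies below `c`, hence the bound y
+ 1. -/
theorem sum_wordsMax_add_single [Fintype ι] (ℓ : ι → ℕ) (c : ι) (n : ℕ)
    [DecidablePred fun V : List (Finset ι) => HeadBelow V c] :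
    ∑ᶠ W ∈ wordsMax (ℓ + Pi.single c 1) c, q ^ wordStat W * qEsymm q W.length n =
      ∑ y ∈ Finset.range n, q ^ y * ∑ᶠ V ∈ words ℓ,
        q ^ wordStat V * qEsymm q V.length (if HeadBelow V c then y + 1 else y) := by
  have hfin := finite_words ℓ
  have hfin' : {V | V ∈ words ℓ ∧ HeadBelow V c}.Finite := hfin.subset fun V hV => hV.1
  have hinj : Set.InjOn (insertHead c) {V | V ∈ words ℓ ∧ HeadBelow V c} := by
    rintro V ⟨_, hV⟩ V' ⟨_, hV'⟩ h
    cases V with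
    | nil => exact hV.elim
    | cons B V =>
      cases V' with
      | nil => exact hV'.elim
      | cons B' V' =>
        have h1 : c ∉ B := fun h => (hV c h).false
        have h2 : c ∉ B' := fun h => (hV' c h).false
        simp only [insertHead, List.cons.injEq] at h
        rw [← Finset.erase_insert h1, h.1, Finset.erase_insert h2, h.2]
  have hdisj : Disjoint ((fun V => {c} :: V) '' words ℓ)
      (insertHead c '' {V | V ∈ words ℓ ∧ HeadBelow V c}) := by
    rw [Set.disjoint_left]
    rintro _ ⟨V, _, rfl⟩ ⟨V', ⟨hV, hV'⟩, h⟩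
    cases V' with
    | nil => exact hV'.elim
    | cons B V' =>
      simp only [insertHead, List.cons.injEq] at h
      obtain ⟨b, hb⟩ := hV.1 B (by simp)
      have : b ∈ ({c} : Finset ι) := h.1 ▸ Finset.mem_insert_of_mem hb
      exact absurd (hV' b hb) (by simp [Finset.mem_singleton.1 this])
  rw [wordsMax_add_single, finsum_mem_union hdisj (hfin.image _) (hfin'.image _),
    finsum_mem_image (fun V _ V' _ h => (List.cons.inj h).2), finsum_mem_image hinj]
  -- If `V` starts below `c`, it comes from two words, and their contributions are the two terms of
  -- `sum_mul_qEsymm_succ`; otherwise only `{c} :: V` occurs, with no forced gap.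
  have hterm : ∀ V ∈ words ℓ, q ^ wordStat ({c} :: V) * qEsymm q (({c} :: V).length) n +
      (if HeadBelow V c then
        q ^ wordStat (insertHead c V) * qEsymm q (insertHead c V).length n else 0) =
      ∑ y ∈ Finset.range n, q ^ y *
        (q ^ wordStat V * qEsymm q V.length (if HeadBelow V c then y + 1 else y)) := by
    intro V hV
    by_cases hc : HeadBelow V c
    · cases V with
      | nil => exact hc.elim
      | cons B V =>
        have e : ∀ y, q ^ y * (q ^ wordStat (B :: V) * qEsymm q (B :: V).length (y + 1)) =
            q ^ wordStat (B :: V) * (q ^ y * qEsymm q (V.length + 1) (y + 1)) := by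
          intro y; simp only [List.length_cons]; ring
        simp only [if_pos hc, e]
        rw [← Finset.mul_sum, sum_mul_qEsymm_succ]
        simp only [insertHead, wordStat, List.length_cons, jump_singleton_of_headBelow hc,
          jump_insert (hV.1 B (by simp)) hc]
        ring
    · have e : ∀ y, q ^ y * (q ^ wordStat V * qEsymm q V.length y) =
          q ^ wordStat V * (q ^ y * qEsymm q V.length y) := by intro y; ring
      simp only [if_neg hc, e]
      rw [← Finset.mul_sum, sum_mul_qEsymm]
      simp only [wordStat, List.length_cons, jump_singleton_of_not_headBelow hc]
      ring
  have hfilter : ∀ f : List (Finset ι) → R, ∑ᶠ V ∈ {V | V ∈ words ℓ ∧ HeadBelow V c}, f V =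
      ∑ᶠ V ∈ words ℓ, if HeadBelow V c then f V else 0 := by
    intro f
    refine finsum_congr fun V => ?_
    by_cases h1 : V ∈ words ℓ <;> by_cases h2 : HeadBelow V c <;> simp [h1, h2]
  rw [hfilter, ← finsum_mem_add_distrib hfin, finsum_mem_congr rfl hterm]
  simp only [finsum_mem_eq_finite_toFinset_sum _ hfin, Finset.mul_sum]
  exact Finset.sum_comm

theorem words_eq_biUnion_wordsMax [Fintype ι] {ℓ : ι → ℕ} (hℓ : ℓ ≠ 0) :
    words ℓ = ⋃ c ∈ (↑(Finset.univ.filter fun c => 0 < ℓ c) : Set ι), wordsMax ℓ c := by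
  ext W
  simp only [Set.mem_iUnion, Finset.mem_coe, Finset.mem_filter, Finset.mem_univ, true_and, exists_prop]
  constructor
  · intro hW
    cases W with
    | nil => exact absurd (by rw [← hW.2]; ext; simp [content]) hℓ
    | cons C V =>
      have hC := hW.1 C (by simp)
      refine ⟨C.max' hC, ?_, hW, C, V, rfl, C.max'_mem hC, fun i hi => C.le_max' i hi⟩
      rw [← hW.2, content_cons]
      simp [C.max'_mem hC]
  · rintro ⟨c, _, hW⟩; exact hW.1

theorem wordsMax_inj {ℓ : ι → ℕ} {b c : ι} {W : List (Finset ι)} (hb : W ∈ wordsMax ℓ b)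
    (hc : W ∈ wordsMax ℓ c) : b = c := by
  obtain ⟨_, B, V, rfl, h1, h2⟩ := hb
  obtain ⟨_, C, V', h, h3, h4⟩ := hc
  obtain ⟨rfl, rfl⟩ := List.cons.inj h
  exact le_antisymm (h4 b h1) (h2 c h3)

/-- The telescoping sum behind the lexicographic order on pairs `(y, c)`. -/
theorem prod_ite_sub_prod [Fintype ι] (f g : ι → R) (P : ι → Prop) [DecidablePred P]
    (hP : ∀ b c, b < c → P c → P b) :
    ∏ b, (if P b then f b else g b) = ∏ b, g b + ∑ c, if P c then
      (f c - g c) * (∏ b ∈ Finset.univ.filter (fun b => b < c), f b) *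
        ∏ b ∈ Finset.univ.filter (fun b => c < b), g b else 0 := by
  have h := Finset.prod_add_ordered Finset.univ g (fun b => if P b then f b - g b else 0)
  have e : ∀ b, (if P b then f b else g b) = g b + if P b then f b - g b else 0 := by
    intro b; split_ifs <;> ring
  simp only [e]
  rw [h]
  congr 1
  refine Finset.sum_congr rfl fun c _ => ?_
  by_cases hc : P c
  · simp only [if_pos hc]
    congr 2
    refine Finset.prod_congr rfl fun b hb => ?_
    rw [if_pos (hP b c (Finset.mem_filter.1 hb).2 hc)]; ring
  · simp [hc]

open Classical in
-- The set `P` of colours allowed to reach height n is needed for the induction: deleting `c`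
-- produces the same statement with `P b` replaced by `b < c`. It must be an initial segment, so
-- that a block lies in `P` as soon as its maximum does.
theorem finsum_words_ite [Fintype ι] (ℓ : ι → ℕ) (P : ι → Prop)
    (hP : ∀ b c, b < c → P c → P b) (n : ℕ) :
    ∑ᶠ V ∈ words ℓ, q ^ wordStat V *
        qEsymm q V.length (if ∃ C U, V = C :: U ∧ ∀ i ∈ C, P i then n + 1 else n) =
      ∏ b, qEsymm q (ℓ b) (if P b then n + 1 else n) := by
  induction hs : ∑ i, ℓ i using Nat.strong_induction_on generalizing ℓ P n with
  | _ s ih =>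
  by_cases hℓ : ℓ = 0
  · subst hℓ
    rw [words_zero]
    simp [wordStat]
  have hprod : ∀ y c, 0 < ℓ c → ∑ᶠ V ∈ words (ℓ - Pi.single c 1), q ^ wordStat V *
      qEsymm q V.length (if HeadBelow V c then y + 1 else y) =
      qEsymm q (ℓ c - 1) y * (∏ b ∈ Finset.univ.filter (fun b => b < c), qEsymm q (ℓ b) (y + 1)) *
        ∏ b ∈ Finset.univ.filter (fun b => c < b), qEsymm q (ℓ b) y := by
    intro y c hc
    have hlt : ∑ i, (ℓ - (Pi.single c 1 : ι → ℕ)) i < s := by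
      rw [← hs]
      refine Finset.sum_lt_sum (fun i _ => by simp) ⟨c, by simp, ?_⟩
      simp; omega
    have h1 := ih _ hlt (ℓ - Pi.single c 1) (fun b => b < c) (fun a b hab hb => hab.trans hb) y rfl
    have hh : ∀ V : List (Finset ι), (∃ C U, V = C :: U ∧ ∀ i ∈ C, i < c) ↔ HeadBelow V c := by
      intro V
      cases V with
      | nil => simp [HeadBelow]
      | cons B V => simp [HeadBelow]
    simp only [hh] at h1
    rw [h1, ← Finset.mul_prod_erase Finset.univ _ (Finset.mem_univ c),
      ← Finset.prod_filter_mul_prod_filter_not (Finset.univ.erase c) (fun b => b < c), mul_assoc]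
    congr 1
    · simp
    · congr 1
      · refine Finset.prod_congr ?_ fun b hb => ?_
        · ext b; simp; exact fun h => h.ne
        · have : b < c := (Finset.mem_filter.1 hb).2
          simp [this, this.ne]
      · refine Finset.prod_congr ?_ fun b hb => ?_
        · ext b
          simp only [Finset.mem_filter, Finset.mem_erase, Finset.mem_univ, and_true, true_and, not_lt]
          exact ⟨fun h => lt_of_le_of_ne h.2 (Ne.symm h.1), fun h => ⟨h.ne', h.le⟩⟩
        · have : c < b := (Finset.mem_filter.1 hb).2
          simp [this.not_gt, this.ne']
  have hmax : ∀ c, 0 < ℓ c → ∀ n, ∑ᶠ W ∈ wordsMax ℓ c, q ^ wordStat W * qEsymm q W.length n =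
      ∑ y ∈ Finset.range n, (qEsymm q (ℓ c) (y + 1) - qEsymm q (ℓ c) y) *
        (∏ b ∈ Finset.univ.filter (fun b => b < c), qEsymm q (ℓ b) (y + 1)) *
        ∏ b ∈ Finset.univ.filter (fun b => c < b), qEsymm q (ℓ b) y := by
    intro c hc n
    have e : ℓ = (ℓ - Pi.single c 1) + Pi.single c 1 := by
      ext b
      by_cases h : b = c
      · subst h; simp; omega
      · simp [h]
    rw [show wordsMax ℓ c = wordsMax ((ℓ - Pi.single c 1) + Pi.single c 1) c by rw [← e],
      sum_wordsMax_add_single]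
    refine Finset.sum_congr rfl fun y _ => ?_
    rw [hprod y c hc, ← mul_qEsymm_pred, if_pos hc]
    ring
  have hP' : ∀ c, ∀ W ∈ wordsMax ℓ c, (∃ C U, W = C :: U ∧ ∀ i ∈ C, P i) ↔ P c := by
    rintro c _ ⟨_, C, V, rfl, h1, h2⟩
    constructor
    · rintro ⟨C', U, h, h'⟩
      obtain ⟨rfl, rfl⟩ := List.cons.inj h
      exact h' c h1
    · intro h
      refine ⟨C, V, rfl, fun i hi => ?_⟩
      rcases (h2 i hi).eq_or_lt with rfl | h3
      · exact h
      · exact hP i c h3 h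
  have hfin : ∀ c, (wordsMax ℓ c).Finite := fun c => (finite_words ℓ).subset fun W hW => hW.1
  rw [words_eq_biUnion_wordsMax hℓ, finsum_mem_biUnion
    (fun b _ c _ hbc => Set.disjoint_left.2 fun W hb hc => hbc (wordsMax_inj hb hc))
    (Finset.finite_toSet _) (fun c _ => hfin c), finsum_mem_coe_finset]
  -- The start of the telescoping: there is no pair of height below 0, yet `ℓ ≠ 0` requires one.
  have hzero : ∏ b, qEsymm q (ℓ b) 0 = 0 := by
    obtain ⟨b, hb⟩ := Function.ne_iff.1 hℓ
    obtain ⟨m, hm⟩ := Nat.exists_eq_succ_of_ne_zero hb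
    exact Finset.prod_eq_zero (Finset.mem_univ b) (by rw [hm]; rfl)
  -- The part of the product whose lexicographically largest pair is (y, c): colours below `c` may
  -- still use height y, those above may not.
  set D : ι → ℕ → R := fun c y => (qEsymm q (ℓ c) (y + 1) - qEsymm q (ℓ c) y) *
        (∏ b ∈ Finset.univ.filter (fun b => b < c), qEsymm q (ℓ b) (y + 1)) *
        ∏ b ∈ Finset.univ.filter (fun b => c < b), qEsymm q (ℓ b) y with hD
  have hD0 : ∀ c y, ¬ 0 < ℓ c → D c y = 0 := by
    intro c y hc
    simp [hD, Nat.eq_zero_of_not_pos hc]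
  have htel : ∀ y, ∏ b, qEsymm q (ℓ b) y = ∑ z ∈ Finset.range y, ∑ c, D c z := by
    intro y
    induction y with
    | zero => simpa using hzero
    | succ y ihy =>
      have := prod_ite_sub_prod (fun b => qEsymm q (ℓ b) (y + 1)) (fun b => qEsymm q (ℓ b) y)
        (fun _ => True) (fun _ _ _ _ => trivial)
      simp only [if_true] at this
      rw [this, Finset.sum_range_succ, ihy]
  -- The largest pair has height below n, or height n and a colour in `P`.
  have hrhs : ∏ b, qEsymm q (ℓ b) (if P b then n + 1 else n) =
      ∑ z ∈ Finset.range n, ∑ c, D c z + ∑ c, if P c then D c n else 0 := by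
    rw [← htel, ← prod_ite_sub_prod _ _ P hP]
    refine Finset.prod_congr rfl fun b _ => ?_
    split_ifs <;> rfl
  rw [hrhs, Finset.sum_comm, ← Finset.sum_add_distrib, Finset.sum_filter]
  refine Finset.sum_congr rfl fun c _ => ?_
  by_cases hc : 0 < ℓ c
  · rw [if_pos hc]
    by_cases hPc : P c
    · rw [if_pos hPc, ← Finset.sum_range_succ, ← hmax c hc]
      refine finsum_mem_congr rfl fun W hW => ?_
      rw [if_pos ((hP' c W hW).2 hPc)]
    · rw [if_neg hPc, add_zero, ← hmax c hc]
      refine finsum_mem_congr rfl fun W hW => ?_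
      rw [if_neg (mt (hP' c W hW).1 hPc)]
  · simp [hD0 c _ hc, hc]

theorem finsum_words [Fintype ι] (ℓ : ι → ℕ) (n : ℕ) :
    ∑ᶠ V ∈ words ℓ, q ^ wordStat V * qEsymm q V.length n = ∏ b, qEsymm q (ℓ b) n := by
  classical
  have h := finsum_words_ite q ℓ (fun _ => False) (fun _ _ _ h => h) n
  simp only [if_false] at h
  rw [← h]
  refine finsum_mem_congr rfl fun V hV => ?_
  rw [if_neg]
  rintro ⟨C, U, rfl, h⟩
  obtain ⟨i, hi⟩ := hV.1 C (by simp)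
  exact h i hi

end words

/-! ### From the values d = -q^n to an identity of polynomials in d -/

/-- At d = -q^n the factor of index m becomes (q^m - q^n)/(1 - q^(m+1)), the ratio of consecutive
terms in `qEsymm_rec`. -/
theorem eval_overGF (m n : ℕ) :
    (overGF m).eval (-(PowerSeries.X ^ n)) = qEsymm (PowerSeries.X : PowerSeries ℤ) m n := by
  induction m with
  | zero => simp [overGF]
  | succ m ih =>
    have h1 := one_sub_X_pow_mul_mk_dvd (show 0 < m + 1 by omega)
    have h2 := qEsymm_rec (PowerSeries.X : PowerSeries ℤ) m n
    have h3 : overGF (m + 1) = overGF m * ((Polynomial.X + Polynomial.C (PowerSeries.X ^ m)) *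
        Polynomial.C (PowerSeries.mk fun n => if m + 1 ∣ n then 1 else 0)) := by
      rw [overGF, Finset.prod_range_succ, ← overGF]
    rw [h3, Polynomial.eval_mul, ih, Polynomial.eval_mul, Polynomial.eval_add, Polynomial.eval_X,
      Polynomial.eval_C, Polynomial.eval_C]
    set G : PowerSeries ℤ := PowerSeries.mk fun n => if m + 1 ∣ n then 1 else 0
    linear_combination qEsymm (PowerSeries.X : PowerSeries ℤ) (m + 1) n * h1 - G * h2

theorem finsum_words_overGF {ι : Type*} [LinearOrder ι] [Fintype ι] (ℓ : ι → ℕ) :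
    ∑ W ∈ (finite_words ℓ).toFinset,
      Polynomial.C (PowerSeries.X ^ wordStat W) * overGF W.length = ∏ b, overGF (ℓ b) := by
  -- The coefficient ring ℤ⟦q⟧ is a domain, so agreement at the infinitely many points -q^n is
  -- enough.
  refine Polynomial.eq_of_infinite_eval_eq _ _ ((Set.infinite_range_of_injective
    (f := fun n : ℕ => -(PowerSeries.X ^ n : PowerSeries ℤ)) ?_).mono ?_)
  · intro m n h
    have h' : (PowerSeries.X ^ m : PowerSeries ℤ) = PowerSeries.X ^ n := neg_injective h
    have := congrArg (PowerSeries.coeff m) h'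
    rw [PowerSeries.coeff_X_pow_self, PowerSeries.coeff_X_pow] at this
    by_contra hmn
    simp [hmn] at this
  · rintro _ ⟨n, rfl⟩
    have h := finsum_words (PowerSeries.X : PowerSeries ℤ) ℓ n
    rw [finsum_mem_eq_finite_toFinset_sum _ (finite_words ℓ)] at h
    simp only [Set.mem_ofPred_eq, Polynomial.eval_finsetSum, Polynomial.eval_mul,
      Polynomial.eval_C, Polynomial.eval_prod, eval_overGF]
    exact h

/-! ### Admissible lists of coloured parts -/

section chains
variable {ι : Type*}

/-- The number of non-overlined parts. -/
def plainCount (l : List (Finset ι × Bool × ℕ)) : ℕ := (l.map fun x => if x.2.1 then 0 else 1).sum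

/-- The sum of the sizes of the parts. -/
def sizeSum (l : List (Finset ι × Bool × ℕ)) : ℕ := (l.map fun x => x.2.2).sum

/-- Increase the size of a part by `c`. -/
def raise (c : ℕ) (x : Finset ι × Bool × ℕ) : Finset ι × Bool × ℕ := (x.1, x.2.1, x.2.2 + c)

theorem map_fst_raise (c : ℕ) (l : List (Finset ι × Bool × ℕ)) :
    (l.map (raise c)).map Prod.fst = l.map Prod.fst := by
  rw [List.map_map]; rfl

theorem plainCount_raise (c : ℕ) (l : List (Finset ι × Bool × ℕ)) :
    plainCount (l.map (raise c)) = plainCount l := by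
  rw [plainCount, List.map_map]; rfl

theorem sizeSum_raise (c : ℕ) (l : List (Finset ι × Bool × ℕ)) :
    sizeSum (l.map (raise c)) = sizeSum l + l.length * c := by
  induction l with
  | nil => simp [sizeSum]
  | cons x l ih =>
    simp only [sizeSum, List.map_cons, List.sum_cons, raise, List.length_cons] at ih ⊢
    rw [ih]; ring

theorem raise_injective (c : ℕ) : Function.Injective (raise (ι := ι) c) := by
  rintro ⟨C, o, s⟩ ⟨C', o', s'⟩ h
  simp only [raise, Prod.mk.injEq] at h
  ext1
  · exact h.1
  · ext1
    · exact h.2.1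
    · exact Nat.add_right_cancel h.2.2

variable [LinearOrder ι]

/-- The difference condition between a part `x` and the next larger part `y`; a part
`(C, o, s)` has colours `C` and size `s`, and is overlined if `o = true`. -/
def Step (x y : Finset ι × Bool × ℕ) : Prop :=
  x.2.2 + jump x.1 [y.1] + (if x.2.1 then 1 else 0) ≤ y.2.2

/-- The admissible lists of parts, the smallest part coming first, with colours `W`. -/
def chains (W : List (Finset ι)) : Set (List (Finset ι × Bool × ℕ)) :=
  {l | l.IsChain Step ∧ l.map Prod.fst = W}

theorem step_raise (c : ℕ) (x y : Finset ι × Bool × ℕ) :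
    Step (raise c x) (raise c y) ↔ Step x y := by
  change x.2.2 + c + jump x.1 [y.1] + (if x.2.1 then 1 else 0) ≤ y.2.2 + c ↔
    x.2.2 + jump x.1 [y.1] + (if x.2.1 then 1 else 0) ≤ y.2.2
  omega

theorem isChain_map_raise (c : ℕ) (l : List (Finset ι × Bool × ℕ)) :
    (l.map (raise c)).IsChain Step ↔ l.IsChain Step := by
  rw [List.isChain_map]
  simp only [step_raise]

theorem le_of_isChain_step {l : List (Finset ι × Bool × ℕ)} {x : Finset ι × Bool × ℕ}
    (h : (x :: l).IsChain Step) : ∀ y ∈ l,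
      x.2.2 + jump x.1 (l.map Prod.fst) + (if x.2.1 then 1 else 0) ≤ y.2.2 := by
  induction l generalizing x with
  | nil => simp
  | cons z l ih =>
    rw [List.isChain_cons_cons] at h
    intro y hy
    have h1 : x.2.2 + jump x.1 ((z :: l).map Prod.fst) + (if x.2.1 then 1 else 0) ≤ z.2.2 := h.1
    rcases List.mem_cons.1 hy with rfl | hy
    · exact h1
    · have := ih h.2 y hy
      omega

/-- Sizes weakly increase along a chain, so the bound on the next part holds for all later ones. It
can therefore be subtracted from the whole tail. -/
theorem isChain_step_cons_iff {l : List (Finset ι × Bool × ℕ)} {x : Finset ι × Bool × ℕ} :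
    (x :: l).IsChain Step ↔ l.IsChain Step ∧ ∀ y ∈ l,
      x.2.2 + jump x.1 (l.map Prod.fst) + (if x.2.1 then 1 else 0) ≤ y.2.2 := by
  refine ⟨fun h => ⟨h.tail, le_of_isChain_step h⟩, fun ⟨h1, h2⟩ => ?_⟩
  cases l with
  | nil => simp
  | cons z l => exact List.isChain_cons_cons.2 ⟨h2 z (by simp), h1⟩

/-- The first part is chosen freely, and the tail is any admissible list raised by the size of that
part and its forced gap. -/
theorem chains_cons (C : Finset ι) (W : List (Finset ι)) :
    chains (C :: W) = (fun z : (Bool × ℕ) × List (Finset ι × Bool × ℕ) => (C, z.1) ::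
      z.2.map (raise (z.1.2 + jump C W + if z.1.1 then 1 else 0))) '' (Set.univ ×ˢ chains W) := by
  ext l
  constructor
  · rintro ⟨h1, h2⟩
    cases l with
    | nil => simp at h2
    | cons x l =>
      obtain ⟨C', o, g⟩ := x
      simp only [List.map_cons, List.cons.injEq] at h2
      obtain ⟨rfl, rfl⟩ := h2
      rw [isChain_step_cons_iff] at h1
      set c := g + jump C' (l.map Prod.fst) + if o then 1 else 0 with hc
      have e : (l.map fun x => (x.1, x.2.1, x.2.2 - c)).map (raise c) = l := by
        rw [List.map_map]
        refine (List.map_congr_left fun y hy => ?_).trans (List.map_id l)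
        have := h1.2 y hy
        simp only [Function.comp, raise, id]
        rw [Nat.sub_add_cancel this]
      refine ⟨((o, g), l.map fun x => (x.1, x.2.1, x.2.2 - c)), ⟨trivial, ?_, ?_⟩, ?_⟩
      · rw [← isChain_map_raise c, e]; exact h1.1
      · rw [← map_fst_raise c, e]
      · simp only [← hc, e]
  · rintro ⟨⟨⟨o, g⟩, l⟩, ⟨-, h1, rfl⟩, rfl⟩
    refine ⟨isChain_step_cons_iff.2 ⟨(isChain_map_raise _ _).2 h1, ?_⟩, ?_⟩
    · intro y hy
      obtain ⟨x, hx, rfl⟩ := List.mem_map.1 hy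
      simp only [map_fst_raise, raise]
      omega
    · exact congrArg (C :: ·) (map_fst_raise _ _)

theorem isGF_chains (W : List (Finset ι)) :
    IsGF (chains W) plainCount sizeSum
      (Polynomial.C (PowerSeries.X ^ wordStat W) * overGF W.length) := by
  induction W with
  | nil =>
    have : chains ([] : List (Finset ι)) = {[]} := by
      ext l
      simp only [chains, Set.mem_ofPred_eq, List.map_eq_nil_iff, Set.mem_singleton_iff]
      exact ⟨fun h => h.2, fun h => ⟨by simp [h], h⟩⟩
    rw [this]
    simpa [wordStat, overGF] using
      IsGF.singleton (k := plainCount (ι := ι)) (T := sizeSum) [] (by rfl) (by rfl)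
  | cons C W ih =>
    rw [chains_cons]
    have h := ((isGF_bool_nat W.length).prod ih).image
      (fun z : (Bool × ℕ) × List (Finset ι × Bool × ℕ) => (C, z.1) ::
        z.2.map (raise (z.1.2 + jump C W + if z.1.1 then 1 else 0)))
      (k' := plainCount) (T' := sizeSum) ?_ (W.length * jump C W) ?_ ?_
    · convert h using 1
      rw [overGF, List.length_cons, Finset.prod_range_succ, ← overGF, wordStat, pow_add, map_mul]
      ring
    · rintro ⟨z, l⟩ - ⟨z', l'⟩ - h
      simp only [List.cons.injEq, Prod.mk.injEq, true_and] at h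
      obtain ⟨rfl, h⟩ := h
      exact Prod.ext rfl ((raise_injective _).list_map h)
    · rintro ⟨z, l⟩ -
      have := plainCount_raise (z.2 + jump C W + if z.1 then 1 else 0) l
      simp only [plainCount, List.map_cons, List.sum_cons] at this ⊢
      rw [this]
    · rintro ⟨z, l⟩ ⟨-, h1, h2⟩
      have hl : l.length = W.length := by rw [← h2]; simp
      have := sizeSum_raise (z.2 + jump C W + if z.1 then 1 else 0) l
      simp only [sizeSum, List.map_cons, List.sum_cons] at this ⊢
      rw [this, hl]; ring

/-- The admissible lists with nonempty colour sets and content `ℓ`. -/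
theorem isGF_biUnion_chains [Fintype ι] (ℓ : ι → ℕ) :
    IsGF {l : List (Finset ι × Bool × ℕ) | l.IsChain Step ∧ l.map Prod.fst ∈ words ℓ}
      plainCount sizeSum (∏ b, overGF (ℓ b)) := by
  rw [← finsum_words_overGF]
  convert IsGF.biUnion (finite_words ℓ).toFinset chains _ (fun W _ => isGF_chains W) ?_ using 1
  · ext l; simp [chains, and_comm]
  · rintro W - V - l h1 h2
    exact h1.2.symm.trans h2.2

/-- Between equal singletons no gap is forced, since `c < c` fails. -/
theorem isGF_chains_replicate (m : ℕ) (c : ι) :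
    IsGF (chains (List.replicate m {c})) plainCount sizeSum (overGF m) := by
  have h : wordStat (List.replicate m ({c} : Finset ι)) = 0 := by
    induction m with
    | zero => rfl
    | succ m ih =>
      rw [List.replicate_succ, wordStat, ih, jump_singleton_of_not_headBelow]
      · simp
      · cases m <;> simp [HeadBelow, List.replicate_succ]
  simpa [h] using isGF_chains (List.replicate m ({c} : Finset ι))

/-- A part `y` that follows `x` in an admissible list read from the largest part. -/
def Precedes (x y : Finset ι × Bool × ℕ) : Prop :=
  y.2.2 < x.2.2 ∨ x.2.2 = y.2.2 ∧ y.2.1 = false ∧ ∃ b, y.1 = {b} ∧ ∃ i ∈ x.1, b ≤ i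

theorem Precedes.trans {x y z : Finset ι × Bool × ℕ} (h : Precedes x y) (h' : Precedes y z) :
    Precedes x z := by
  rcases h with h | ⟨h, -, b, hb, i, hi, hbi⟩ <;>
    rcases h' with h' | ⟨h', ho, c, hc, j, hj, hcj⟩
  · exact Or.inl (h'.trans h)
  · exact Or.inl (h' ▸ h)
  · exact Or.inl (h ▸ h')
  · rw [hb, Finset.mem_singleton] at hj
    exact Or.inr ⟨h.trans h', ho, c, hc, i, hi, hcj.trans (hj ▸ hbi)⟩

theorem Precedes.antisymm {x y : Finset ι × Bool × ℕ} (h : Precedes x y) (h' : Precedes y x) :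
    x = y := by
  rcases h with h | ⟨h, ho, b, hb, i, hi, hbi⟩ <;>
    rcases h' with h' | ⟨h', ho', c, hc, j, hj, hcj⟩
  · omega
  · omega
  · omega
  · rw [hb, Finset.mem_singleton] at hj
    rw [hc, Finset.mem_singleton] at hi
    subst hi hj
    have := le_antisymm hbi hcj
    subst this
    ext1
    · rw [hb, hc]
    · ext1
      · rw [ho, ho']
      · exact h

/-- At equal sizes no gap is forced: the smaller part is non-overlined, its colour set is a
singleton `{b}`, and `b` is not above the whole next colour set. -/
theorem Step.precedes {x y : Finset ι × Bool × ℕ} (hx : x.1.Nonempty) (h : Step x y) :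
    Precedes y x := by
  by_cases hlt : x.2.2 < y.2.2
  · exact Or.inl hlt
  · rw [Step] at h
    have hcard := hx.card_pos
    have h0 : jump x.1 [y.1] = 0 := by omega
    have ho : x.2.1 = false := by
      by_contra ho
      rw [Bool.not_eq_false] at ho
      simp [ho] at h
      omega
    simp only [jump] at h0
    obtain ⟨b, hb⟩ := Finset.card_eq_one.1 (show x.1.card = 1 by omega)
    refine Or.inr ⟨by omega, ho, b, hb, ?_⟩
    have h1 : ¬ ∀ j ∈ x.1, HeadBelow [y.1] j := by
      intro hh
      rw [if_pos hh] at h0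
      omega
    simpa [hb, HeadBelow] using h1

theorem pairwise_precedes {l : List (Finset ι × Bool × ℕ)} (h : l.IsChain Step)
    (hne : ∀ x ∈ l, x.1.Nonempty) : l.Pairwise fun x y => Precedes y x := by
  have h' : l.IsChain fun x y => Precedes y x := by
    induction l with
    | nil => simp
    | cons x l ih =>
      cases l with
      | nil => simp
      | cons y l =>
        rw [List.isChain_cons_cons] at h ⊢
        exact ⟨h.1.precedes (hne x (by simp)), ih h.2 fun z hz => hne z (by simp [hz])⟩
  have : IsTrans (Finset ι × Bool × ℕ) fun x y => Precedes y x := ⟨fun _ _ _ h1 h2 => h2.trans h1⟩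
  exact h'.pairwise

/-- An overpartition has at most one admissible listing, because `Precedes` is transitive and
antisymmetric. Counting lists is thus counting multisets. -/
theorem eq_of_perm_of_isChain {l l' : List (Finset ι × Bool × ℕ)} (h : l.IsChain Step)
    (h' : l'.IsChain Step) (hne : ∀ x ∈ l, x.1.Nonempty) (hp : l.Perm l') : l = l' :=
  hp.eq_of_pairwise (fun _ _ _ _ h1 h2 => h2.antisymm h1) (pairwise_precedes h hne)
    (pairwise_precedes h' fun x hx => hne x (hp.mem_iff.2 hx))

/-- Two copies of an overlined `x` would give `Precedes x x`, whose only possible case needs `x`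
non-overlined. -/
theorem count_overlined_le_one {l : List (Finset ι × Bool × ℕ)} (h : l.IsChain Step)
    (hne : ∀ x ∈ l, x.1.Nonempty) (x : Finset ι × Bool × ℕ) (hx : x.2.1 = true) :
    (l : Multiset (Finset ι × Bool × ℕ)).count x ≤ 1 := by
  by_contra hc
  obtain ⟨l', hp, hs⟩ : ([x, x] : List (Finset ι × Bool × ℕ)).Subperm l :=
    Multiset.le_count_iff_replicate_le.1 (not_le.1 hc)
  have h2 : l'.Pairwise fun x y => Precedes y x := (pairwise_precedes h hne).sublist hs
  rw [List.perm_replicate (n := 2) |>.1 hp] at h2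
  rcases List.rel_of_pairwise_cons h2 (List.mem_singleton_self x) with h | h
  · omega
  · simp [hx] at h

/-- Overpartitions whose parts all have colour `c` can be listed admissibly. -/
theorem exists_isChain_of_colour (c : ι) (π : Multiset (Finset ι × Bool × ℕ))
    (hc : ∀ x ∈ π, x.1 = {c}) (h1 : ∀ x, x.2.1 = true → π.count x ≤ 1) :
    ∃ l : List (Finset ι × Bool × ℕ), (l : Multiset _) = π ∧ l.IsChain Step := by
  -- Sorting by this key puts an overlined part after the plain parts of its size, as it must be
  -- strictly smaller than its successor.
  set key : Finset ι × Bool × ℕ → ℕ := fun x => 2 * x.2.2 + if x.2.1 then 1 else 0 with hkey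
  obtain ⟨l₀, rfl⟩ := Quot.exists_rep π
  set l := l₀.mergeSort (fun x y => decide (key x ≤ key y)) with hl
  have hperm : l.Perm l₀ := List.mergeSort_perm _ _
  have hsort : l.Pairwise fun x y => key x ≤ key y := by
    have := List.pairwise_mergeSort (le := fun x y => decide (key x ≤ key y))
      (fun a b c => by simpa using fun h1 h2 => le_trans h1 h2)
      (fun a b => by simpa using le_total (key a) (key b)) l₀
    simpa using this
  have hnd : l.Pairwise fun x y => ¬ (x = y ∧ x.2.1 = true) := by
    rw [List.pairwise_iff_forall_sublist]
    rintro x y hs ⟨rfl, ho⟩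
    have h2 : 2 ≤ (l : Multiset (Finset ι × Bool × ℕ)).count x :=
      Multiset.le_count_iff_replicate_le.2 (show Multiset.replicate 2 x ≤ (l : Multiset (Finset ι × Bool × ℕ)) from
        (hs.subperm : [x, x].Subperm l))
    rw [Multiset.coe_eq_coe.2 hperm] at h2
    exact absurd (h1 x ho) (not_le.2 h2)
  refine ⟨l, Quot.sound hperm, (List.Pairwise.isChain ?_)⟩
  refine ((hsort.and hnd).imp_of_mem ?_)
  rintro ⟨C, o, s⟩ ⟨C', o', s'⟩ hx hy ⟨h, h'⟩
  have e1 : C = {c} := hc (C, o, s) (hperm.mem_iff.1 hx)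
  have e2 : C' = {c} := hc (C', o', s') (hperm.mem_iff.1 hy)
  subst e1 e2
  have hj : jump ({c} : Finset ι) [{c}] = 0 :=
    jump_singleton_of_not_headBelow (by simp [HeadBelow])
  simp only [Step, hj, hkey] at h ⊢
  cases o <;> cases o' <;> simp at h h' ⊢ <;> omega

end chains

/-! ### The E side: overpartitions as admissible lists -/

section encoding
variable {r : ℕ} {a : Fin r → ℕ} {N : ℕ}

theorem Superincreasing.strictMono (ha : Superincreasing a) : StrictMono a := fun i k hik =>
  (Finset.single_le_sum (f := a) (fun _ _ => Nat.zero_le _) (by simp [hik])).trans_lt (ha k)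

theorem leastPosResidue_mul_add {α : ℕ} (s : ℕ) (h0 : 0 < α) (h : α ≤ N) :
    leastPosResidue N (N * s + α) = α := by
  rw [leastPosResidue, Nat.mul_add_mod]
  rcases h.eq_or_lt with rfl | h
  · simp
  · rw [Nat.mod_eq_of_lt h, if_neg h0.ne']

variable (a N) in
/-- The part of an overpartition encoded by `(C, o, s)`. -/
def encode (σ : Equiv.Perm (Fin r)) (x : Finset (Fin r) × Bool × ℕ) : ℕ × Bool :=
  (N * x.2.2 + ∑ i ∈ x.1, a (σ.symm i), x.2.1)

variable (a N) in
/-- The inverse of `encode`. -/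
noncomputable def decode (σ : Equiv.Perm (Fin r)) (p : ℕ × Bool) : Finset (Fin r) × Bool × ℕ :=
  ((termIndices a (leastPosResidue N p.1)).map σ.toEmbedding, p.2, (p.1 - 1) / N)

theorem sum_symm_pos (ha : Superincreasing a) (σ : Equiv.Perm (Fin r)) {C : Finset (Fin r)}
    (hC : C.Nonempty) : 0 < ∑ i ∈ C, a (σ.symm i) :=
  Finset.sum_pos (fun _ _ => (Nat.zero_le _).trans_lt (ha _)) hC

theorem sum_symm_le (hN : ∑ i, a i ≤ N) (σ : Equiv.Perm (Fin r)) (C : Finset (Fin r)) :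
    ∑ i ∈ C, a (σ.symm i) ≤ N := by
  refine (Finset.sum_le_sum_of_subset (Finset.subset_univ C)).trans ?_
  rwa [Equiv.sum_comp σ.symm a]

theorem sum_symm_eq_sum_map (σ : Equiv.Perm (Fin r)) (C : Finset (Fin r)) :
    ∑ i ∈ C, a (σ.symm i) = ∑ i ∈ C.map σ.symm.toEmbedding, a i := by
  simp [Finset.sum_map]

theorem leastPosResidue_encode (ha : Superincreasing a) (hN : ∑ i, a i ≤ N)
    (σ : Equiv.Perm (Fin r)) {x : Finset (Fin r) × Bool × ℕ} (hx : x.1.Nonempty) :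
    leastPosResidue N (encode a N σ x).1 = ∑ i ∈ x.1, a (σ.symm i) :=
  leastPosResidue_mul_add _ (sum_symm_pos ha σ hx) (sum_symm_le hN σ _)

theorem termIndices_encode (ha : Superincreasing a) (hN : ∑ i, a i ≤ N)
    (σ : Equiv.Perm (Fin r)) {x : Finset (Fin r) × Bool × ℕ} (hx : x.1.Nonempty) :
    termIndices a (leastPosResidue N (encode a N σ x).1) = x.1.map σ.symm.toEmbedding := by
  rw [leastPosResidue_encode ha hN σ hx, sum_symm_eq_sum_map]
  exact termIndices_sum ha (by simpa using hx)

theorem decode_encode (ha : Superincreasing a) (hN0 : 0 < N) (hN : ∑ i, a i ≤ N)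
    (σ : Equiv.Perm (Fin r)) {x : Finset (Fin r) × Bool × ℕ} (hx : x.1.Nonempty) :
    decode a N σ (encode a N σ x) = x := by
  rw [decode, termIndices_encode ha hN σ hx]
  have h0 := sum_symm_pos ha σ hx
  have h1 := sum_symm_le hN σ x.1
  ext1
  · ext i; simp
  · ext1
    · rfl
    · simp only [encode]
      -- Residues run over 1, …, N, so the size is (p - 1) / N: the residue N must not carry into
      -- the quotient.
      rw [Nat.add_sub_assoc h0, Nat.mul_add_div hN0, Nat.div_eq_of_lt (by omega), add_zero]

theorem exists_encode (hN : ∑ i, a i ≤ N)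
    (σ : Equiv.Perm (Fin r)) {p : ℕ × Bool} {I : Finset (Fin r)} (hp : 0 < p.1)
    (h : p.1 ≡ ∑ i ∈ I, a i [MOD N]) :
    ∃ s, encode a N σ (I.map σ.toEmbedding, p.2, s) = p := by
  have h1 : ∑ i ∈ I, a i ≤ N := (Finset.sum_le_sum_of_subset (Finset.subset_univ I)).trans hN
  -- Otherwise the difference would be a multiple of N strictly between 0 and N.
  have hle : ∑ i ∈ I, a i ≤ p.1 := by
    by_contra hlt
    rw [not_le] at hlt
    have hd : N ∣ ∑ i ∈ I, a i - p.1 := (Nat.modEq_iff_dvd' hlt.le).1 h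
    have := Nat.le_of_dvd (by omega) hd
    omega
  obtain ⟨s, hs⟩ := (Nat.modEq_iff_dvd' hle).1 h.symm
  refine ⟨s, Prod.ext ?_ rfl⟩
  simp only [encode, Finset.sum_map, Equiv.coe_toEmbedding, Equiv.symm_apply_apply]
  omega

theorem exists_encode_of_mem_setAN' (hN : ∑ i, a i ≤ N)
    (σ : Equiv.Perm (Fin r)) {p : ℕ × Bool} (hp : p.1 ∈ setAN' a N) :
    ∃ x : Finset (Fin r) × Bool × ℕ, x.1.Nonempty ∧ encode a N σ x = p := by
  obtain ⟨hp0, _, ⟨I, hI, rfl⟩, h⟩ := hp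
  obtain ⟨s, hs⟩ := exists_encode hN σ hp0 h
  exact ⟨_, by simpa using hI, hs⟩

theorem encode_pos (ha : Superincreasing a) (σ : Equiv.Perm (Fin r))
    {x : Finset (Fin r) × Bool × ℕ} (hx : x.1.Nonempty) : 0 < (encode a N σ x).1 :=
  Nat.add_pos_right _ (sum_symm_pos ha σ hx)

theorem encode_mem_setAN' (ha : Superincreasing a) (σ : Equiv.Perm (Fin r))
    {x : Finset (Fin r) × Bool × ℕ} (hx : x.1.Nonempty) : (encode a N σ x).1 ∈ setAN' a N := by
  refine ⟨encode_pos ha σ hx, _, ⟨x.1.map σ.symm.toEmbedding, by simpa using hx, rfl⟩, ?_⟩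
  rw [← sum_symm_eq_sum_map]
  simp [encode, Nat.ModEq]

theorem deltaA_sum (ha : Superincreasing a) {C D : Finset (Fin r)} (hC : C.Nonempty)
    (hD : D.Nonempty) [Decidable (∀ j ∈ D, ∀ i ∈ C, i < j)] :
    deltaA a (∑ i ∈ C, a i) (∑ i ∈ D, a i) = if ∀ j ∈ D, ∀ i ∈ C, i < j then 1 else 0 := by
  rw [deltaA, zA, vA, termIndices_sum ha hC, termIndices_sum ha hD]
  refine if_congr ?_ rfl rfl
  obtain ⟨d, hd⟩ := hD
  constructor
  · intro h j hj i hi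
    rw [← ha.strictMono.lt_iff_lt]
    exact (Finset.le_sup hi).trans_lt (h.trans_le (Nat.sInf_le ⟨j, hj, rfl⟩))
  · intro h
    obtain ⟨j, hj, he⟩ := Nat.sInf_mem (s := {x | ∃ i ∈ D, a i = x}) ⟨_, d, hd, rfl⟩
    rw [← he, Finset.sup_lt_iff ((Nat.zero_le _).trans_lt (ha j))]
    exact fun i hi => ha.strictMono (h j hj i hi)

/-- The residues cancel and N divides out. Since colour sets are stored after applying σ, `deltaA`
compares them directly. The arguments are swapped because chains start from the smallest part. -/
theorem diffCond_encode (ha : Superincreasing a) (hN0 : 0 < N) (hN : ∑ i, a i ≤ N)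
    (σ : Equiv.Perm (Fin r)) {x y : Finset (Fin r) × Bool × ℕ} (hx : x.1.Nonempty)
    (hy : y.1.Nonempty) : DiffCond a N σ (encode a N σ x) (encode a N σ y) ↔ Step y x := by
  have hperm : ∀ z : Finset (Fin r) × Bool × ℕ, z.1.Nonempty →
      permSum a σ (leastPosResidue N (encode a N σ z).1) = ∑ i ∈ z.1, a i := by
    intro z hz
    rw [permSum, termIndices_encode ha hN σ hz]
    simp [Finset.sum_map]
  classical
  have hjump : jump y.1 [x.1] = y.1.card - 1 + if ∀ j ∈ y.1, ∀ i ∈ x.1, i < j then 1 else 0 := by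
    rw [jump]
    by_cases h : ∀ j ∈ y.1, ∀ i ∈ x.1, i < j
    · rw [if_pos h, if_pos (show ∀ j ∈ y.1, HeadBelow [x.1] j from h)]
    · rw [if_neg h, if_neg (show ¬ ∀ j ∈ y.1, HeadBelow [x.1] j from h)]
  have hchi : chi (encode a N σ y) = if y.2.1 then 1 else 0 := rfl
  rw [DiffCond, hperm x hx, hperm y hy, deltaA_sum ha hx hy, wA, termIndices_encode ha hN σ hy,
    leastPosResidue_encode ha hN σ hx, leastPosResidue_encode ha hN σ hy, Finset.card_map, hchi,
    Step, hjump]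
  have hcard := hy.card_pos
  generalize (if ∀ j ∈ y.1, ∀ i ∈ x.1, i < j then 1 else 0 : ℕ) = δ
  generalize (if y.2.1 = true then 1 else 0 : ℕ) = χ
  simp only [encode]
  push_cast
  have hNpos : (0 : ℤ) < N := by exact_mod_cast hN0
  constructor
  · intro h
    have h1 : (N : ℤ) * ((y.1.card : ℤ) - 1 + χ + δ) ≤ N * ((x.2.2 : ℤ) - y.2.2) := by linarith
    have := le_of_mul_le_mul_left h1 hNpos
    omega
  · intro h
    have h1 : (y.1.card : ℤ) - 1 + χ + δ ≤ (x.2.2 : ℤ) - y.2.2 := by omega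
    have := mul_le_mul_of_nonneg_left h1 hNpos.le
    linarith

/-- The residues contribute an amount depending only on the content of the word. -/
theorem sum_map_encode (σ : Equiv.Perm (Fin r)) (l : List (Finset (Fin r) × Bool × ℕ)) :
    ((l.map (encode a N σ)).map Prod.fst).sum =
      N * sizeSum l + ∑ i, content (Fin r) (l.map Prod.fst) (σ i) * a i := by
  rw [← Equiv.sum_comp σ.symm]
  simp only [Equiv.apply_symm_apply]
  induction l with
  | nil => simp [sizeSum, content]
  | cons x l ih =>
    have e : ∑ i, (if i ∈ x.1 then 1 else 0) * a (σ.symm i) = ∑ i ∈ x.1, a (σ.symm i) := by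
      simp [ite_mul, Finset.sum_ite_mem]
    simp only [List.map_cons, List.sum_cons, content_cons, Pi.add_apply, add_mul,
      Finset.sum_add_distrib, ih, e, sizeSum, encode]
    ring

theorem numNonOverlined_map_encode (σ : Equiv.Perm (Fin r))
    (l : List (Finset (Fin r) × Bool × ℕ)) :
    numNonOverlined (l.map (encode a N σ) : Multiset (ℕ × Bool)) = plainCount l := by
  rw [numNonOverlined, Multiset.coe_countP, List.countP_map, plainCount]
  induction l with
  | nil => rfl
  | cons x l ih =>
    rw [List.countP_cons, ih, List.map_cons, List.sum_cons, add_comm]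
    congr 1
    obtain ⟨C, o, s⟩ := x
    cases o <;> simp [encode]

theorem overlined_once_map_encode (ha : Superincreasing a) (hN0 : 0 < N) (hN : ∑ i, a i ≤ N)
    (σ : Equiv.Perm (Fin r)) {l : List (Finset (Fin r) × Bool × ℕ)} (hl : l.IsChain Step)
    (hne : ∀ x ∈ l, x.1.Nonempty) (m : ℕ) :
    (l.map (encode a N σ) : Multiset (ℕ × Bool)).count (m, true) ≤ 1 := by
  by_cases hm : (m, true) ∈ (l.map (encode a N σ) : Multiset (ℕ × Bool))
  · obtain ⟨x, hx, hxm⟩ := List.mem_map.1 (Multiset.mem_coe.1 hm)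
    rw [← hxm, ← Multiset.map_coe, Multiset.count_map_eq_count _ _ ?_ _ (Multiset.mem_coe.2 hx)]
    · exact count_overlined_le_one hl hne x (congrArg Prod.snd hxm)
    · intro y hy z hz h
      rw [← decode_encode ha hN0 hN σ (hne y hy), h, decode_encode ha hN0 hN σ (hne z hz)]
  · rw [Multiset.count_eq_zero_of_notMem hm]; exact Nat.zero_le _

theorem eq_of_map_encode_eq (ha : Superincreasing a) (hN0 : 0 < N) (hN : ∑ i, a i ≤ N)
    (σ : Equiv.Perm (Fin r)) {l l' : List (Finset (Fin r) × Bool × ℕ)} (hl : l.IsChain Step)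
    (hl' : l'.IsChain Step) (hne : ∀ x ∈ l, x.1.Nonempty) (hne' : ∀ x ∈ l', x.1.Nonempty)
    (h : (l.map (encode a N σ) : Multiset (ℕ × Bool)) = (l'.map (encode a N σ) : Multiset _)) :
    l = l' := by
  have hdec : ∀ l : List (Finset (Fin r) × Bool × ℕ), (∀ x ∈ l, x.1.Nonempty) →
      (l.map (encode a N σ)).map (decode a N σ) = l := by
    intro l hl
    rw [List.map_map]
    exact (List.map_congr_left fun x hx => decode_encode ha hN0 hN σ (hl x hx)).trans
      (List.map_id l)
  refine eq_of_perm_of_isChain hl hl' hne ?_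
  have := (Multiset.coe_eq_coe.1 h).map (decode a N σ)
  rwa [hdec l hne, hdec l' hne'] at this

/-- Admissible lists are the listings λ_1, …, λ_s read backwards, and the content is transported by
σ. -/
theorem setE_eq_image (ha : Superincreasing a) (hN0 : 0 < N) (hN : ∑ i, a i ≤ N)
    (ℓ : Fin r → ℕ) (k n : ℕ) (σ : Equiv.Perm (Fin r)) :
    setE a N σ ℓ k n = (fun l : List (Finset (Fin r) × Bool × ℕ) =>
      (l.map (encode a N σ) : Multiset (ℕ × Bool))) ''
        {l | l ∈ {l : List (Finset (Fin r) × Bool × ℕ) |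
          l.IsChain Step ∧ l.map Prod.fst ∈ words fun i => ℓ (σ.symm i)} ∧
          plainCount l = k ∧ N * sizeSum l + ∑ i, ℓ i * a i = n} := by
  have hcontent : ∀ l : List (Finset (Fin r) × Bool × ℕ), (∀ x ∈ l, x.1.Nonempty) → ∀ i,
      (l.map (encode a N σ) : Multiset (ℕ × Bool)).countP
        (fun p => i ∈ termIndices a (leastPosResidue N p.1)) =
      content (Fin r) (l.map Prod.fst) (σ i) := by
    intro l hl i
    rw [Multiset.coe_countP, List.countP_map, content, List.countP_map]
    refine List.countP_congr fun x hx => ?_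
    simp [termIndices_encode ha hN σ (hl x hx)]
  ext π
  constructor
  · rintro ⟨⟨-, -, hsum⟩, hA, hk, hℓ, l, rfl, hl⟩
    have hA' : ∀ p ∈ l, p.1 ∈ setAN' a N := hA
    obtain ⟨z, hz, rfl⟩ : ∃ z : List (Finset (Fin r) × Bool × ℕ), (∀ x ∈ z, x.1.Nonempty) ∧
        z.map (encode a N σ) = l := by
      clear hsum hk hℓ hl hA
      induction l with
      | nil => exact ⟨[], by simp, rfl⟩
      | cons p l ih =>
        obtain ⟨x, hx, rfl⟩ := exists_encode_of_mem_setAN' hN σ (hA' p (by simp))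
        obtain ⟨z, hz, rfl⟩ := ih fun q hq => hA' q (by simp [hq])
        refine ⟨x :: z, fun y hy => ?_, rfl⟩
        rcases List.mem_cons.1 hy with rfl | hy
        · exact hx
        · exact hz y hy
    have hrev : (z.reverse.map (encode a N σ) : Multiset (ℕ × Bool)) = z.map (encode a N σ) :=
      Multiset.coe_eq_coe.2 ((List.reverse_perm z).map _)
    have hz' : ∀ x ∈ z.reverse, x.1.Nonempty := fun x hx => hz x (List.mem_reverse.1 hx)
    rw [← hrev] at hk hℓ hsum
    have hc : content (Fin r) (z.reverse.map Prod.fst) = fun i => ℓ (σ.symm i) := by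
      ext i
      have := hℓ (σ.symm i)
      rwa [hcontent _ hz', Equiv.apply_symm_apply] at this
    refine ⟨z.reverse, ⟨⟨?_, ?_, hc⟩, ?_, ?_⟩, hrev⟩
    · rw [List.isChain_reverse]
      rw [List.isChain_map] at hl
      clear * - hl hz ha hN0 hN
      induction z with
      | nil => simp
      | cons x z ih =>
        cases z with
        | nil => simp
        | cons y z =>
          rw [List.isChain_cons_cons] at hl ⊢
          exact ⟨(diffCond_encode ha hN0 hN σ (hz x (by simp)) (hz y (by simp))).1 hl.1,
            ih (fun w hw => hz w (List.mem_cons_of_mem _ hw)) hl.2⟩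
    · intro C hC
      obtain ⟨x, hx, rfl⟩ := List.mem_map.1 hC
      exact hz' x hx
    · rw [← hk, numNonOverlined_map_encode]
    · rw [Multiset.map_coe, Multiset.sum_coe, sum_map_encode, hc] at hsum
      simpa using hsum
  · rintro ⟨l, ⟨⟨hl, hne, hc⟩, hk, hn⟩, rfl⟩
    have hne' : ∀ x ∈ l, x.1.Nonempty := fun x hx => hne _ (List.mem_map_of_mem hx)
    refine ⟨⟨?_, overlined_once_map_encode ha hN0 hN σ hl hne', ?_⟩, ?_, ?_, ?_,
      (l.map (encode a N σ)).reverse, ?_, ?_⟩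
    · intro p hp
      obtain ⟨x, hx, rfl⟩ := List.mem_map.1 (Multiset.mem_coe.1 hp)
      exact encode_pos ha σ (hne' x hx)
    · rw [Multiset.map_coe, Multiset.sum_coe, sum_map_encode, hc]
      simpa using hn
    · intro p hp
      obtain ⟨x, hx, rfl⟩ := List.mem_map.1 (Multiset.mem_coe.1 hp)
      exact encode_mem_setAN' ha σ (hne' x hx)
    · rw [numNonOverlined_map_encode, hk]
    · intro i
      rw [hcontent l hne', hc]; simp
    · exact Multiset.coe_eq_coe.2 (List.reverse_perm _)
    · rw [List.isChain_reverse, List.isChain_map]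
      clear * - hl hne' ha hN0 hN
      induction l with
      | nil => simp
      | cons x l ih =>
        cases l with
        | nil => simp
        | cons y l =>
          rw [List.isChain_cons_cons] at hl ⊢
          exact ⟨(diffCond_encode ha hN0 hN σ (hne' y (by simp)) (hne' x (by simp))).2 hl.1,
            ih hl.2 fun w hw => hne' w (List.mem_cons_of_mem _ hw)⟩

theorem ncard_setE (ha : Superincreasing a) (hN0 : 0 < N) (hN : ∑ i, a i ≤ N)
    (ℓ : Fin r → ℕ) (k n : ℕ) (σ : Equiv.Perm (Fin r)) :
    (setE a N σ ℓ k n).ncard = {l | l ∈ {l : List (Finset (Fin r) × Bool × ℕ) |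
          l.IsChain Step ∧ l.map Prod.fst ∈ words fun i => ℓ (σ.symm i)} ∧
          plainCount l = k ∧ N * sizeSum l + ∑ i, ℓ i * a i = n}.ncard := by
  rw [setE_eq_image ha hN0 hN, Set.InjOn.ncard_image]
  rintro l ⟨⟨h1, h2, -⟩, -⟩ l' ⟨⟨h1', h2', -⟩, -⟩ h
  exact eq_of_map_encode_eq ha hN0 hN σ h1 h1' (fun x hx => h2 _ (List.mem_map_of_mem hx))
    (fun x hx => h2' _ (List.mem_map_of_mem hx)) h

end encoding

/-! ### The D side: one list for each colour -/

section colours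
variable {r : ℕ} {a : Fin r → ℕ} {N : ℕ}

theorem Superincreasing.modEq_iff (ha : Superincreasing a) (hN : ∑ i, a i ≤ N) {i j : Fin r} :
    a i ≡ a j [MOD N] ↔ i = j := by
  refine ⟨fun h => ?_, fun h => h ▸ Nat.ModEq.refl _⟩
  have hpos : ∀ i, 0 < a i := fun i => (Nat.zero_le _).trans_lt (ha i)
  have hle : ∀ i, a i ≤ N := fun i =>
    (Finset.single_le_sum (f := a) (fun _ _ => Nat.zero_le _) (Finset.mem_univ i)).trans hN
  have key : ∀ i j, a i < a j → ¬ a i ≡ a j [MOD N] := by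
    intro i j hij h
    have := Nat.le_of_dvd (by omega) ((Nat.modEq_iff_dvd' hij.le).1 h)
    have := hpos i
    have := hle j
    omega
  rcases lt_trichotomy (a i) (a j) with h' | h' | h'
  · exact absurd h (key i j h')
  · exact ha.strictMono.injective h'
  · exact absurd h.symm (key j i h')

theorem encode_singleton_modEq (c : Fin r) (o : Bool) (s : ℕ) :
    (encode a N (Equiv.refl _) ({c}, o, s)).1 ≡ a c [MOD N] := by
  simp [encode, Nat.ModEq]

/-- The overpartition whose parts of colour `c` are listed by `g c`. -/
def assemble (a : Fin r → ℕ) (N : ℕ) (g : Fin r → List (Finset (Fin r) × Bool × ℕ)) :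
    Multiset (ℕ × Bool) :=
  ∑ c, ((g c).map (encode a N (Equiv.refl _)) : Multiset (ℕ × Bool))

theorem fst_of_mem_chains_replicate {ι : Type*} [LinearOrder ι] {m : ℕ} {c : ι}
    {l : List (Finset ι × Bool × ℕ)} (hl : l ∈ chains (List.replicate m {c})) :
    ∀ x ∈ l, x.1 = {c} := fun x hx =>
  List.eq_of_mem_replicate (hl.2 ▸ List.mem_map_of_mem hx : x.1 ∈ List.replicate m {c})

theorem nonempty_of_mem_chains_replicate {ι : Type*} [LinearOrder ι] {m : ℕ} {c : ι}
    {l : List (Finset ι × Bool × ℕ)} (hl : l ∈ chains (List.replicate m {c})) :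
    ∀ x ∈ l, x.1.Nonempty := fun x hx => by
  rw [fst_of_mem_chains_replicate hl x hx]; simp

theorem modEq_of_mem_map_encode {m : ℕ} {c : Fin r} {l : List (Finset (Fin r) × Bool × ℕ)}
    (hl : l ∈ chains (List.replicate m {c})) :
    ∀ p ∈ (l.map (encode a N (Equiv.refl _)) : Multiset (ℕ × Bool)), p.1 ≡ a c [MOD N] := by
  intro p hp
  obtain ⟨⟨C, o, s⟩, hx, rfl⟩ := List.mem_map.1 (Multiset.mem_coe.1 hp)
  obtain rfl : C = {c} := fst_of_mem_chains_replicate hl _ hx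
  exact encode_singleton_modEq c o s

/-- Different colours have different residues, so each class modulo N gives back its own list; this
makes `assemble` injective on these families. -/
theorem filter_assemble (ha : Superincreasing a) (hN : ∑ i, a i ≤ N) {ℓ : Fin r → ℕ}
    {g : Fin r → List (Finset (Fin r) × Bool × ℕ)}
    (hg : ∀ c, g c ∈ chains (List.replicate (ℓ c) {c})) (c : Fin r) :
    (assemble a N g).filter (fun p => p.1 ≡ a c [MOD N]) =
      ((g c).map (encode a N (Equiv.refl _)) : Multiset (ℕ × Bool)) := by
  have h : (assemble a N g).filter (fun p => p.1 ≡ a c [MOD N]) =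
      ∑ b, ((g b).map (encode a N (Equiv.refl _)) : Multiset (ℕ × Bool)).filter
        (fun p => p.1 ≡ a c [MOD N]) := by
    rw [assemble]
    exact map_sum (⟨⟨Multiset.filter fun p : ℕ × Bool => p.1 ≡ a c [MOD N], Multiset.filter_zero _⟩,
      Multiset.filter_add _⟩ : Multiset (ℕ × Bool) →+ Multiset (ℕ × Bool)) _ _
  rw [h, Finset.sum_eq_single c]
  · exact Multiset.filter_eq_self.2 (modEq_of_mem_map_encode (hg c))
  · intro b _ hbc
    refine Multiset.filter_eq_nil.2 fun p hp hpc => hbc ?_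
    exact (ha.modEq_iff hN).1 ((modEq_of_mem_map_encode (hg b) p hp).symm.trans hpc)
  · simp

theorem sum_filter_modEq (ha : Superincreasing a) (hN : ∑ i, a i ≤ N)
    {π : Multiset (ℕ × Bool)} (hπ : ∀ p ∈ π, p.1 ∈ setAN a N) :
    ∑ c, π.filter (fun p => p.1 ≡ a c [MOD N]) = π := by
  ext p
  rw [Multiset.count_sum']
  simp only [Multiset.count_filter]
  by_cases hp : p ∈ π
  · obtain ⟨-, b, hb⟩ := hπ p hp
    rw [Finset.sum_eq_single b]
    · rw [if_pos hb]
    · intro c _ hcb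
      exact if_neg fun h => hcb ((ha.modEq_iff hN).1 (h.symm.trans hb))
    · simp
  · simp [Multiset.count_eq_zero_of_notMem hp]

/-- Split by residue class: within one class the only constraint is that overlined parts do not
repeat, and sorting makes the class an admissible list of equal singletons. -/
theorem setD_eq_image (ha : Superincreasing a) (hN0 : 0 < N) (hN : ∑ i, a i ≤ N)
    (ℓ : Fin r → ℕ) (k n : ℕ) :
    setD a N ℓ k n = assemble a N '' {g | g ∈ {g : Fin r → List (Finset (Fin r) × Bool × ℕ) |
      ∀ c, g c ∈ chains (List.replicate (ℓ c) {c})} ∧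
      ∑ c, plainCount (g c) = k ∧ N * ∑ c, sizeSum (g c) + ∑ i, ℓ i * a i = n} := by
  have hsum : ∀ g : Fin r → List (Finset (Fin r) × Bool × ℕ),
      (∀ c, g c ∈ chains (List.replicate (ℓ c) {c})) →
      ((assemble a N g).map Prod.fst).sum = N * ∑ c, sizeSum (g c) + ∑ i, ℓ i * a i := by
    intro g hg
    have h1 : ((assemble a N g).map Prod.fst).sum =
        ∑ c, (((g c).map (encode a N (Equiv.refl _)) : Multiset (ℕ × Bool)).map Prod.fst).sum :=
      map_sum (Multiset.sumAddMonoidHom.comp (Multiset.mapAddMonoidHom Prod.fst)) _ _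
    rw [h1, Finset.mul_sum, ← Finset.sum_add_distrib]
    refine Finset.sum_congr rfl fun c _ => ?_
    rw [Multiset.map_coe, Multiset.sum_coe, sum_map_encode, (hg c).2]
    congr 1
    rw [Finset.sum_eq_single c]
    · simp [content, List.countP_replicate]
    · intro b _ hbc
      simp [content, List.countP_replicate, hbc]
    · simp
  have hplain : ∀ g : Fin r → List (Finset (Fin r) × Bool × ℕ),
      numNonOverlined (assemble a N g) = ∑ c, plainCount (g c) := by
    intro g
    have h1 : numNonOverlined (assemble a N g) =
        ∑ c, numNonOverlined ((g c).map (encode a N (Equiv.refl _)) : Multiset (ℕ × Bool)) :=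
      map_sum (Multiset.countPAddMonoidHom fun p : ℕ × Bool => p.2 = false) _ _
    rw [h1]
    exact Finset.sum_congr rfl fun c _ => numNonOverlined_map_encode _ _
  have hcount : ∀ (π : Multiset (ℕ × Bool)) c, π.countP (fun p => p.1 ≡ a c [MOD N]) =
      (π.filter fun p => p.1 ≡ a c [MOD N]).card := fun π c => Multiset.countP_eq_card_filter _ _
  ext π
  constructor
  · rintro ⟨⟨hpos, hover, hn⟩, hA, hk, hℓ⟩
    have hex : ∀ c, ∃ l ∈ chains (List.replicate (ℓ c) {c}),
        (l.map (encode a N (Equiv.refl _)) : Multiset (ℕ × Bool)) =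
          π.filter fun p => p.1 ≡ a c [MOD N] := by
      intro c
      set ρ := π.filter fun p => p.1 ≡ a c [MOD N] with hρ
      have henc : ∀ p ∈ ρ, ∃ s, encode a N (Equiv.refl _) ({c}, p.2, s) = p := by
        intro p hp
        obtain ⟨hp, hpc⟩ := Multiset.mem_filter.1 hp
        obtain ⟨s, hs⟩ := exists_encode hN (Equiv.refl _) (I := {c}) (hpos p hp) (by simpa using hpc)
        exact ⟨s, by simpa using hs⟩
      have hdec : ∀ p ∈ ρ, (decode a N (Equiv.refl _) p).1 = {c} ∧
          encode a N (Equiv.refl _) (decode a N (Equiv.refl _) p) = p := by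
        intro p hp
        obtain ⟨s, hs⟩ := henc p hp
        rw [← hs, decode_encode ha hN0 hN _ (by simp)]
        exact ⟨rfl, rfl⟩
      obtain ⟨l, hl, hchain⟩ := exists_isChain_of_colour c (ρ.map (decode a N (Equiv.refl _))) (by
          intro x hx
          obtain ⟨p, hp, rfl⟩ := Multiset.mem_map.1 hx
          exact (hdec p hp).1) (by
          intro x hx
          by_cases hmem : x ∈ ρ.map (decode a N (Equiv.refl _))
          · obtain ⟨p, hp, rfl⟩ := Multiset.mem_map.1 hmem
            rw [Multiset.count_map_eq_count _ _ ?_ _ hp]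
            · have h1 : ρ.count p ≤ π.count p := Multiset.count_le_of_le _ (Multiset.filter_le _ _)
              have h2 : p = (p.1, true) := Prod.ext rfl hx
              rw [h2] at h1 ⊢
              exact h1.trans (hover _)
            · intro p hp p' hp' h
              rw [← (hdec p hp).2, h, (hdec p' hp').2]
          · rw [Multiset.count_eq_zero_of_notMem hmem]; exact Nat.zero_le _)
      have hmap : (l.map (encode a N (Equiv.refl _)) : Multiset (ℕ × Bool)) = ρ := by
        rw [← Multiset.map_coe, hl, Multiset.map_map]
        exact (Multiset.map_congr rfl fun p hp => (hdec p hp).2).trans (Multiset.map_id' ρ)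
      refine ⟨l, ⟨hchain, List.eq_replicate_iff.2 ⟨?_, ?_⟩⟩, hmap⟩
      · rw [← hℓ c, hcount, ← hρ, ← hmap]; simp
      · intro C hC
        obtain ⟨x, hx, rfl⟩ := List.mem_map.1 hC
        rw [← Multiset.mem_coe, hl] at hx
        obtain ⟨p, hp, rfl⟩ := Multiset.mem_map.1 hx
        exact (hdec p hp).1
    choose g hg hgπ using hex
    have hπ : assemble a N g = π := by
      rw [assemble, Finset.sum_congr rfl fun c _ => hgπ c]
      exact sum_filter_modEq ha hN hA
    exact ⟨g, ⟨hg, by rw [← hplain, hπ, hk], by rw [← hsum g hg, hπ, hn]⟩, hπ⟩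
  · rintro ⟨g, ⟨hg, hk, hn⟩, rfl⟩
    have hmem : ∀ p ∈ assemble a N g, 0 < p.1 ∧ ∃ c, p.1 ≡ a c [MOD N] := by
      intro p hp
      obtain ⟨c, -, hp⟩ := Multiset.mem_sum.1 hp
      refine ⟨?_, c, modEq_of_mem_map_encode (hg c) p hp⟩
      obtain ⟨x, hx, rfl⟩ := List.mem_map.1 (Multiset.mem_coe.1 hp)
      exact encode_pos ha _ (nonempty_of_mem_chains_replicate (hg c) x hx)
    refine ⟨⟨fun p hp => (hmem p hp).1, ?_, (hsum g hg).trans hn⟩, hmem, (hplain g).trans hk, ?_⟩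
    · intro m
      by_cases hm : (m, true) ∈ assemble a N g
      · obtain ⟨-, c, hc⟩ := hmem _ hm
        rw [← Multiset.count_filter_of_pos (p := fun p : ℕ × Bool => p.1 ≡ a c [MOD N]) hc,
          filter_assemble ha hN hg]
        exact overlined_once_map_encode ha hN0 hN _ (hg c).1
          (nonempty_of_mem_chains_replicate (hg c)) m
      · rw [Multiset.count_eq_zero_of_notMem hm]; exact Nat.zero_le _
    · intro c
      rw [hcount, filter_assemble ha hN hg, Multiset.coe_card, List.length_map]
      simpa using congrArg List.length (hg c).2

theorem ncard_setD (ha : Superincreasing a) (hN0 : 0 < N) (hN : ∑ i, a i ≤ N)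
    (ℓ : Fin r → ℕ) (k n : ℕ) :
    (setD a N ℓ k n).ncard = {g | g ∈ {g : Fin r → List (Finset (Fin r) × Bool × ℕ) |
      ∀ c, g c ∈ chains (List.replicate (ℓ c) {c})} ∧
      ∑ c, plainCount (g c) = k ∧ N * ∑ c, sizeSum (g c) + ∑ i, ℓ i * a i = n}.ncard := by
  rw [setD_eq_image ha hN0 hN, Set.InjOn.ncard_image]
  rintro g ⟨hg, -⟩ g' ⟨hg', -⟩ h
  ext1 c
  refine eq_of_map_encode_eq ha hN0 hN (Equiv.refl _) (hg c).1 (hg' c).1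
    (nonempty_of_mem_chains_replicate (hg c)) (nonempty_of_mem_chains_replicate (hg' c)) ?_
  rw [← filter_assemble ha hN hg, ← filter_assemble ha hN hg', h]

end colours

/-! ### Comparison of the two sides -/

theorem theorem1p11 {r : ℕ} (a : Fin r → ℕ) (ha : Superincreasing a)
    (N : ℕ) (hN0 : 0 < N) (hN : ∑ i, a i ≤ N)
    (ℓ : Fin r → ℕ) (k n : ℕ) (σ : Equiv.Perm (Fin r)) :
    (setD a N ℓ k n).ncard = (setE a N σ ℓ k n).ncard := by
  have hE := isGF_biUnion_chains fun i => ℓ (σ.symm i)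
  -- σ only permutes the factors of the product, so it disappears from the generating function.
  rw [Equiv.prod_comp σ.symm fun i => overGF (ℓ i)] at hE
  rw [ncard_setD ha hN0 hN, ncard_setE ha hN0 hN]
  exact (IsGF.pi fun c => isGF_chains_replicate (ℓ c) c).ncard_eq_ncard hE hN0 _ _ _
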